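/- Let $p$ be a prime, $q=p^f$ with $f\ge 1$, and $n\ge 2$. Let $\mathbf{G}=\mathrm{SL}_n(\overline{\mathbb{F}}_p)$ with the Frobenius endomorphism $F$ raising all matrix entries to the $q$-th power, so that $G=\mathbf{G}^F=\mathrm{SL}_n(q)$. Let $\mathbf{T}\le\mathbf{G}$ be the torus of diagonal matrices, $T=\mathbf{T}^F$ and $N=\mathrm{N}_G(\mathbf{T})$. For a root $\alpha$ with root subgroup $x_\alpha(t)=1+tE_{ij}$ ($i\neq j$) put $n_\alpha(1)=x_\alpha(1)x_{-\alpha}(-1)x_\alpha(1)$, and let $V\le N$ be the subgroup generated by all $n_\alpha(1)$. Let $\mathbf{G}^*=\mathrm{PGL}_n(\overline{\mathbb{F}}_p)$, again with the $q$-power Frobenius endomorphism $F$, let $\mathbf{T}^*$ be its diagonal torus and $T^*=(\mathbf{T}^*)^F$. Fix an injective homomorphism $\kappa:\overline{\mathbb{F}}_p^\times\to\mathbb{C}^\times$ and a generator $\zeta$ of $\mathbb{F}_q^\times$. These determine the duality isomorphism $\mathrm{Irr}(T)\cong T^*$, under which, for $a\in\mathbb{Z}^n$, the character $\mathrm{diag}(t_1,\dots,t_n)\mapsto\prod_{i}\kappa(t_i)^{a_i}$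 of $T$ corresponds to the image in $T^*$ of $\mathrm{diag}(\zeta^{a_1},\dots,\zeta^{a_n})$. Let $\lambda\in\mathrm{Irr}(T)$ with corresponding element $s\in T^*$. Write $N_\lambda$ and $V_\lambda$ for the stabilizers of $\lambda$ in $N$ and $V$, and let $A(s)=\mathrm{C}_{\mathbf{G}^*}(s)/\mathrm{C}^\circ_{\mathbf{G}^*}(s)$ be the group of connected components of the centralizer of $s$, with the induced action of $F$ and fixed points $A(s)^F$. For a positive integer $m$ let $(m)_2$ denote the largest power of $2$ dividing $m$. Then $\lambda$ has no extension to a character $\hat\lambda\in\mathrm{Irr}(N_\lambda)$ whose restriction to $V_\lambda$ is rational-valued if and only if $$(n)_2=(q-1)_2=|A(s)^F|_2=2.$$ -/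

import Mathlib

open Matrix
open scoped MatrixGroups Pointwise

noncomputable section

/-! ### Ordinary characters -/

/-- `χ ∈ Irr(X)`: the function `χ` is the character of an irreducible complex representation of
`X` (of some finite degree `d`, realised on `ℂ^d`). -/
def IsIrrChar {X : Type*} [Group X] (χ : X → ℂ) : Prop :=
  ∃ (d : ℕ) (ρ : Representation ℂ X (Fin d → ℂ)), ρ.IsIrreducible ∧ χ = ρ.character

/-- For subgroups `X`, `Y` of `Γ` and a function `ψ` on `X`, the stabilizer `Y_ψ` of `ψ` under
conjugation: those `y ∈ Y` normalizing `X` with `ψ (y x y⁻¹) = ψ x` for all `x ∈ X`. -/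
def charStabilizer {Γ : Type*} [Group Γ] (Y X : Subgroup Γ) (ψ : X → ℂ) : Subgroup Γ where
  carrier := {y | y ∈ Y ∧ ∃ hy : ∀ x, x ∈ X ↔ y * x * y⁻¹ ∈ X,
    ∀ x : X, ψ ⟨y * x * y⁻¹, (hy x).1 x.2⟩ = ψ x}
  one_mem' := ⟨Y.one_mem, fun x => by simp, fun x => by simp⟩
  mul_mem' := by
    rintro a b ⟨ha, na, fa⟩ ⟨hb, nb, fb⟩
    have e : ∀ x, a * b * x * (a * b)⁻¹ = a * (b * x * b⁻¹) * a⁻¹ := fun x => by group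
    refine ⟨Y.mul_mem ha hb, fun x => ?_, fun x => ?_⟩
    · rw [e, ← na, ← nb]
    · rw [← fb x, ← fa ⟨b * x * b⁻¹, (nb x).1 x.2⟩]
      congr 1
      exact Subtype.ext (e x)
  inv_mem' := by
    rintro a ⟨ha, na, fa⟩
    have e : ∀ x, a * (a⁻¹ * x * a⁻¹⁻¹) * a⁻¹ = x := fun x => by group
    refine ⟨Y.inv_mem ha, fun x => ?_, fun x => ?_⟩
    · rw [na (a⁻¹ * x * a⁻¹⁻¹), e]
    · have hx : a⁻¹ * x * a⁻¹⁻¹ ∈ X := by rw [na, e]; exact x.2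
      rw [← fa ⟨_, hx⟩]
      congr 1
      exact Subtype.ext (e x)

/-! ### The group `SL_n`, its Frobenius endomorphism, maximal torus and extended Weyl group -/

/-- The diagonal matrices with invertible entries. -/
def diagGL (n : ℕ) (K : Type*) [Field K] : (Fin n → Kˣ) →* GL (Fin n) K :=
  (Units.map (Matrix.diagonalRingHom (Fin n) K).toMonoidHom).comp
    MulEquiv.piUnits.symm.toMonoidHom

/-- The Frobenius endomorphism of `SL_n(K)` raising all matrix entries to the `p^f`-th power. -/
def frobSL (p f n : ℕ) (K : Type*) [Field K] [ExpChar K p] : SL(n, K) →* SL(n, K) :=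
  Matrix.SpecialLinearGroup.map (iterateFrobenius K p f)

/-- The finite group `G = SL_n(p^f)`, as the group of Frobenius fixed points in `SL_n(K)`. -/
def finiteSL (p f n : ℕ) (K : Type*) [Field K] [ExpChar K p] : Subgroup SL(n, K) :=
  (frobSL p f n K).eqLocus (MonoidHom.id _)

/-- The diagonal maximal torus of the algebraic group `SL_n(K)`. -/
def torusSL (n : ℕ) (K : Type*) [Field K] : Subgroup SL(n, K) :=
  (diagGL n K).range.comap Matrix.SpecialLinearGroup.toGL

/-- The maximally split torus `T` of `G = SL_n(p^f)`: Frobenius fixed points of the diagonal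
torus. -/
def finiteTorus (p f n : ℕ) (K : Type*) [Field K] [ExpChar K p] : Subgroup SL(n, K) :=
  torusSL n K ⊓ finiteSL p f n K

/-- The normalizer in `G = SL_n(p^f)` of the (algebraic) diagonal torus. -/
def finiteTorusNormalizer (p f n : ℕ) (K : Type*) [Field K] [ExpChar K p] :
    Subgroup SL(n, K) :=
  Subgroup.normalizer (torusSL n K : Set SL(n, K)) ⊓ finiteSL p f n K

/-- The element `n_α(1) = x_α(1) x_{-α}(-1) x_α(1)`, where `α` is the root of `SL_n` with root
subgroup `x_α(t) = 1 + t E_{ij}`. -/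
def rootWeylElt {n : ℕ} (K : Type*) [Field K] {i j : Fin n} (hij : i ≠ j) : SL(n, K) :=
  Matrix.SpecialLinearGroup.transvection hij 1 *
    Matrix.SpecialLinearGroup.transvection hij.symm (-1) *
    Matrix.SpecialLinearGroup.transvection hij 1

/-- The extended Weyl group `V`, generated by the elements `n_α(1)` for all roots `α`. -/
def extendedWeyl (n : ℕ) (K : Type*) [Field K] : Subgroup SL(n, K) :=
  Subgroup.closure {g | ∃ (i j : Fin n) (hij : i ≠ j), g = rootWeylElt K hij}

/-- `N_λ`, the stabilizer of `λ ∈ Irr(T)` in the normalizer `N` in `G` of the diagonal torus. -/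
def torusNormalizerStabilizer {p f n : ℕ} {K : Type*} [Field K] [ExpChar K p]
    (lam : finiteTorus p f n K → ℂ) : Subgroup SL(n, K) :=
  charStabilizer (finiteTorusNormalizer p f n K) (finiteTorus p f n K) lam

/-- `V_λ`, the stabilizer of `λ ∈ Irr(T)` in the extended Weyl group `V`. -/
def extendedWeylStabilizer {p f n : ℕ} {K : Type*} [Field K] [ExpChar K p]
    (lam : finiteTorus p f n K → ℂ) : Subgroup SL(n, K) :=
  charStabilizer (extendedWeyl n K) (finiteTorus p f n K) lam

/-! ### The dual group `PGL_n` -/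

/-- The Frobenius endomorphism of `PGL_n(K)` raising all matrix entries to the `p^f`-th power. -/
def frobPGL (p f n : ℕ) (K : Type*) [Field K] [ExpChar K p] : PGL(n, K) →* PGL(n, K) :=
  QuotientGroup.map (Subgroup.center (GL (Fin n) K)) (Subgroup.center (GL (Fin n) K))
    (Matrix.GeneralLinearGroup.map (iterateFrobenius K p f))
    (Matrix.GeneralLinearGroup.map_center_le _)

/-- The maximally split torus `T*` of `G* = PGL_n(p^f)`: the Frobenius fixed points of the image
in `PGL_n(K)` of the diagonal matrices. -/
def finiteDualTorus (p f n : ℕ) (K : Type*) [Field K] [ExpChar K p] : Subgroup PGL(n, K) :=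
  (diagGL n K).range.map Matrix.ProjGenLinGroup.mk ⊓
    (frobPGL p f n K).eqLocus (MonoidHom.id _)

/-- The Zariski topology on the affine space of `n × n` matrices: the non-vanishing loci of
polynomials in the matrix entries form a basis. -/
abbrev zariskiMatrix (n : ℕ) (K : Type*) [Field K] :
    TopologicalSpace (Matrix (Fin n) (Fin n) K) :=
  TopologicalSpace.generateFrom
    {U | ∃ P : MvPolynomial (Fin n × Fin n) K,
      U = {M | MvPolynomial.eval (fun ij => M ij.1 ij.2) P ≠ 0}}

/-- The Zariski topology on `GL_n(K)`, an open subset of the affine space of matrices. -/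
abbrev zariskiGL (n : ℕ) (K : Type*) [Field K] : TopologicalSpace (GL (Fin n) K) :=
  (zariskiMatrix n K).induced (fun g => (g : Matrix (Fin n) (Fin n) K))

/-- The Zariski topology on `PGL_n(K)`, the quotient of `GL_n(K)` by its centre. -/
abbrev zariskiPGL (n : ℕ) (K : Type*) [Field K] : TopologicalSpace PGL(n, K) :=
  (zariskiGL n K).coinduced Matrix.ProjGenLinGroup.mk

/-- The identity component `C°(s)` of the centralizer `C(s)` of `s` in `PGL_n(K)`: its
connected component of `1` in the Zariski topology. -/
def centralizerComponent {n : ℕ} {K : Type*} [Field K] (s : PGL(n, K)) : Set PGL(n, K) :=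
  @connectedComponentIn _ (zariskiPGL n K)
    (Subgroup.centralizer {s} : Set PGL(n, K)) 1

/-- `A(s)^F`: the cosets `g C°(s)`, `g ∈ C(s)`, in the component group `A(s) = C(s) / C°(s)` that
are fixed by the Frobenius, i.e. `F(g) C°(s) = g C°(s)`. -/
def componentGroupFixed (p f : ℕ) {n : ℕ} {K : Type*} [Field K] [ExpChar K p]
    (s : PGL(n, K)) : Set (Set PGL(n, K)) :=
  {X | ∃ g ∈ Subgroup.centralizer {s}, X = g • centralizerComponent s ∧
    X = frobPGL p f n K g • centralizerComponent s}

/-! ### Duality -/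

/-- `λ ∈ Irr(T)` and `s ∈ T*` correspond to each other under the isomorphism
`Irr(T) ≅ X/(q-1)X ≅ Y*/(q-1)Y* ≅ T*`, where `X = ℤⁿ/ℤ(1,…,1)` is the character lattice of the
diagonal torus of `SL_n` and is also the cocharacter lattice `Y*` of the diagonal torus of
`PGL_n`. The first isomorphism sends a character to its composition with the embedding
`κ : Kˣ → ℂˣ`, restricted to `T`; the last one sends a cocharacter to its value at the generator
`ζ` of the multiplicative group of the field with `q` elements. -/
def DualCorrespond {p f n : ℕ} {K : Type*} [Field K] [ExpChar K p] (κ : Kˣ →* ℂˣ) (ζ : Kˣ)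
    (lam : finiteTorus p f n K → ℂ) (s : PGL(n, K)) : Prop :=
  ∃ a : Fin n → ℤ,
    s = Matrix.ProjGenLinGroup.mk (diagGL n K fun i => ζ ^ a i) ∧
    ∀ (t : finiteTorus p f n K) (d : Fin n → Kˣ),
      Matrix.SpecialLinearGroup.toGL (t : SL(n, K)) = diagGL n K d →
        lam t = ((∏ i, κ (d i) ^ a i : ℂˣ) : ℂ)

end

/-! Let `λ` have exponent vector `a`. An element of `N` is a monomial matrix with permutation `w`
and entries `u` in `F_q`. It fixes `λ` exactly when `a (w i) ≡ e + a i` modulo `q - 1` for some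
shift `e` independent of `i` (`mem_charStabilizer_finiteTorus_iff`).

The natural candidate for an extension is `∏ κ(u i) ^ a (w i)`. The determinant condition `∏ u i =
sign w` shows that it fails to be multiplicative by the sign cocycle `κ(sign w) ^ e'`, with `e'` the
shift of the left factor. Correcting by a `±1`-valued function `h` of `w` that trivialises the
cocycle gives a linear character with values `±1` on `V_λ` (`exists_rational_extension`). In
characteristic 2, or if all shifts are even, `h = 1` works. If `q` is odd and an odd shift exists,
it swaps the indices with odd and with even `a i`; when `4 ∣ n`, `h` is built from the sign on one
half (`exists_sign_coboundary`).

On the dual side, `A(s)` is the cyclic group of scalars `c` for which multiplication by `c` permutes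
the eigenvalues `ζ ^ a i` with multiplicities; Frobenius acts trivially and the order divides `n`
(`ncard_componentGroupFixed`, `card_eigenShifts_dvd`). An odd shift `e₀` gives an element `ζ ^ e₀`
whose order has the full 2-part of `q - 1`. So if also `4 ∤ n`, then `n`, `q - 1` and `|A(s)|` all
have 2-part 2.

In that remaining case `-1` lies in `A(s)`. It is realised by a fixed-point-free involution with `n
/ 2` transpositions, an odd number. A lift `v ∈ V_λ` satisfies `λ(v²) = -1`, while an extension is
linear, so a rational value at `v` would have square `-1` (`not_exists_rational_extension`). -/

/-! ### Zariski topology and the sets `g D = c D g` -/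

section Zariski

variable {n : ℕ} {K : Type*} [Field K]

/-- Basic open sets form a neighbourhood basis of the Zariski topology on matrices. -/
lemma exists_eval_ne_zero_of_isOpen {U : Set (Matrix (Fin n) (Fin n) K)}
    (hU : @IsOpen _ (zariskiMatrix n K) U) {M : Matrix (Fin n) (Fin n) K} (hM : M ∈ U) :
    ∃ P : MvPolynomial (Fin n × Fin n) K, MvPolynomial.eval (fun ij => M ij.1 ij.2) P ≠ 0 ∧
      ∀ N : Matrix (Fin n) (Fin n) K, MvPolynomial.eval (fun ij => N ij.1 ij.2) P ≠ 0 → N ∈ U := by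
  change TopologicalSpace.GenerateOpen _ U at hU
  induction hU with
  | basic s hs =>
    obtain ⟨P, rfl⟩ := hs
    exact ⟨P, hM, fun N hN => hN⟩
  | univ => exact ⟨1, by simp, fun _ _ => trivial⟩
  | inter s t _ _ ihs iht =>
    obtain ⟨P, hP, hPs⟩ := ihs hM.1
    obtain ⟨Q, hQ, hQt⟩ := iht hM.2
    refine ⟨P * Q, by simpa using ⟨hP, hQ⟩, fun N hN => ?_⟩
    rw [map_mul, mul_ne_zero_iff] at hN
    exact ⟨hPs N hN.1, hQt N hN.2⟩
  | sUnion S _ ih =>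
    obtain ⟨s, hs, hMs⟩ := hM
    obtain ⟨P, hP, hPs⟩ := ih s hs hMs
    exact ⟨P, hP, fun N hN => ⟨s, hs, hPs N hN⟩⟩

/-- Polynomial functions on matrices restrict to polynomial functions on lines. -/
lemma exists_polynomial_eval_line (P : MvPolynomial (Fin n × Fin n) K)
    (M N : Matrix (Fin n) (Fin n) K) :
    ∃ p : Polynomial K, ∀ t, p.eval t =
      MvPolynomial.eval (fun ij => (N + t • (M - N)) ij.1 ij.2) P := by
  refine ⟨MvPolynomial.aeval (fun ij : Fin n × Fin n =>
    Polynomial.C (N ij.1 ij.2) + Polynomial.X * Polynomial.C ((M - N) ij.1 ij.2)) P, fun t => ?_⟩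
  induction P using MvPolynomial.induction_on with
  | C a => simp
  | add p q hp hq => rw [map_add, Polynomial.eval_add, hp, hq, map_add]
  | mul_X p i hp =>
    rw [map_mul, Polynomial.eval_mul, hp, map_mul, MvPolynomial.aeval_X, MvPolynomial.eval_X]
    simp

/-- The zero locus of a family of polynomials is Zariski closed in `GL_n`. -/
lemma isClosed_zariskiGL_zeroLocus {ι : Type*} (P : ι → MvPolynomial (Fin n × Fin n) K) :
    @IsClosed _ (zariskiGL n K)
      {g | ∀ k, MvPolynomial.eval (fun ij => (g : Matrix (Fin n) (Fin n) K) ij.1 ij.2) (P k) = 0} := by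
  let := zariskiGL n K
  rw [Set.ofPred_forall]
  refine isClosed_iInter fun k => ⟨?_⟩
  exact ⟨{M | MvPolynomial.eval (fun ij => M ij.1 ij.2) (P k) ≠ 0},
    TopologicalSpace.isOpen_generateFrom_of_mem ⟨P k, rfl⟩, rfl⟩

/-- Invertible matrices `g` with `g D = c D g`, where `D = diag(σ)`. -/
def scaledCommutant (σ : Fin n → Kˣ) (c : Kˣ) : Set (GL (Fin n) K) :=
  {g | ∀ i j, (g : Matrix (Fin n) (Fin n) K) i j * σ j = c * σ i * g i j}

lemma mem_scaledCommutant_iff {σ : Fin n → Kˣ} {c : Kˣ} {g : GL (Fin n) K} :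
    g ∈ scaledCommutant σ c ↔ (g : Matrix (Fin n) (Fin n) K) * diagonal (fun i => (σ i : K)) =
      (c : K) • (diagonal (fun i => (σ i : K)) * (g : Matrix (Fin n) (Fin n) K)) := by
  rw [← Matrix.ext_iff]
  simp only [scaledCommutant, Set.mem_ofPred_eq, Matrix.mul_diagonal, Matrix.smul_apply,
    Matrix.diagonal_mul, smul_eq_mul, mul_assoc]

lemma one_mem_scaledCommutant (σ : Fin n → Kˣ) : 1 ∈ scaledCommutant σ 1 := by
  simp [mem_scaledCommutant_iff]

lemma mul_mem_scaledCommutant {σ : Fin n → Kˣ} {c d : Kˣ} {g h : GL (Fin n) K}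
    (hg : g ∈ scaledCommutant σ c) (hh : h ∈ scaledCommutant σ d) :
    g * h ∈ scaledCommutant σ (c * d) := by
  rw [mem_scaledCommutant_iff] at *
  rw [Units.val_mul, mul_assoc, hh, mul_smul_comm, ← mul_assoc, hg, smul_mul_assoc, smul_smul,
    mul_assoc, Units.val_mul, mul_comm (d : K)]

lemma inv_mem_scaledCommutant {σ : Fin n → Kˣ} {c : Kˣ} {g : GL (Fin n) K}
    (hg : g ∈ scaledCommutant σ c) : g⁻¹ ∈ scaledCommutant σ c⁻¹ := by
  rw [mem_scaledCommutant_iff] at *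
  set D := diagonal fun i => (σ i : K)
  have h := congrArg (fun M => (c⁻¹ : K) • (((g⁻¹ : GL (Fin n) K) : Matrix (Fin n) (Fin n) K) * M *
    ((g⁻¹ : GL (Fin n) K) : Matrix (Fin n) (Fin n) K))) hg
  simp only [← mul_assoc, Units.inv_mul, one_mul, mul_smul_comm, smul_mul_assoc, smul_smul] at h
  rw [mul_assoc _ _ ((g⁻¹ : GL (Fin n) K) : Matrix (Fin n) (Fin n) K), Units.mul_inv, mul_one,
    inv_mul_cancel₀ c.ne_zero, one_smul] at h
  rw [← h, Units.val_inv_eq_inv_val]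

lemma scalar_mem_scaledCommutant (σ : Fin n → Kˣ) (u : Kˣ) :
    GeneralLinearGroup.scalar (Fin n) u ∈ scaledCommutant σ 1 := by
  rw [mem_scaledCommutant_iff]
  simp [GeneralLinearGroup.scalar, mul_comm]

lemma isClosed_scaledCommutant (σ : Fin n → Kˣ) (c : Kˣ) :
    @IsClosed _ (zariskiGL n K) (scaledCommutant σ c) := by
  convert isClosed_zariskiGL_zeroLocus (fun k : Fin n × Fin n =>
    (MvPolynomial.X k * MvPolynomial.C (σ k.2 : K) -
      MvPolynomial.C ((c : K) * σ k.1) * MvPolynomial.X k : MvPolynomial (Fin n × Fin n) K)) using 1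
  ext g
  simp [scaledCommutant, sub_eq_zero]

/-- The commutant is the invertible part of a linear space. On the line through two of its points,
two basic open conditions and invertibility become nonzero one-variable polynomials, which have a
common non-root over an infinite field. -/
lemma isPreirreducible_scaledCommutant_one [Infinite K] (σ : Fin n → Kˣ) :
    @IsPreirreducible _ (zariskiGL n K) (scaledCommutant σ 1) := by
  rintro u v ⟨U, hU, rfl⟩ ⟨V, hV, rfl⟩ ⟨g, hgS, hgU⟩ ⟨h, hhS, hhV⟩
  obtain ⟨P, hP, hPU⟩ := exists_eval_ne_zero_of_isOpen hU hgU
  obtain ⟨Q, hQ, hQV⟩ := exists_eval_ne_zero_of_isOpen hV hhV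
  obtain ⟨p, hp⟩ := exists_polynomial_eval_line P (g : Matrix (Fin n) (Fin n) K) h
  obtain ⟨q, hq⟩ := exists_polynomial_eval_line Q (g : Matrix (Fin n) (Fin n) K) h
  obtain ⟨d, hd⟩ := exists_polynomial_eval_line (Matrix.det (Matrix.mvPolynomialX (Fin n) (Fin n) K))
    (g : Matrix (Fin n) (Fin n) K) h
  have hd' : ∀ t, d.eval t = (h.1 + t • (g.1 - h.1)).det := fun t => by
    rw [hd, RingHom.map_det]
    congr 1
    ext i j
    simp [Matrix.mvPolynomialX]
  have hp0 : p ≠ 0 := by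
    rintro rfl
    apply hP
    simpa using (hp 1).symm
  have hq0 : q ≠ 0 := by
    rintro rfl
    apply hQ
    simpa using (hq 0).symm
  have hd0 : d ≠ 0 := by
    rintro rfl
    have := (hd' 0).symm
    simp only [Polynomial.eval_zero, zero_smul, add_zero] at this
    exact ((Matrix.isUnit_iff_isUnit_det _).1 h.isUnit).ne_zero this
  obtain ⟨t, ht⟩ : ∃ t, (p * q * d).eval t ≠ 0 := by
    by_contra! H
    exact mul_ne_zero (mul_ne_zero hp0 hq0) hd0
      (Polynomial.funext fun t => by rw [H t, Polynomial.eval_zero])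
  rw [Polynomial.eval_mul, Polynomial.eval_mul, mul_ne_zero_iff, mul_ne_zero_iff] at ht
  obtain ⟨⟨htp, htq⟩, htd⟩ := ht
  rw [hd'] at htd
  obtain ⟨x, hx⟩ := (Matrix.isUnit_iff_isUnit_det _).2 (isUnit_iff_ne_zero.2 htd)
  rw [hp, ← hx] at htp
  rw [hq, ← hx] at htq
  refine ⟨x, fun i j => ?_, hPU _ htp, hQV _ htq⟩
  have h1 := hgS i j
  have h2 := hhS i j
  rw [hx]
  simp only [Units.val_one, one_mul] at h1 h2
  simp only [Units.val_one, one_mul, Matrix.add_apply, Matrix.smul_apply, Matrix.sub_apply,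
    smul_eq_mul]
  linear_combination (1 - t) * h2 + t * h1

end Zariski

/-! ### The component group of a centralizer in `PGL_n` -/

section Component

variable {n : ℕ} {K : Type*} [Field K]

/-- The factors `c` for which `c · diag(σ)` is conjugate to `diag(σ)`. -/
def eigenShifts (σ : Fin n → Kˣ) : Subgroup Kˣ where
  carrier := {c | ∃ w : Equiv.Perm (Fin n), ∀ i, σ (w i) = c * σ i}
  one_mem' := ⟨1, by simp⟩
  mul_mem' := by
    rintro c d ⟨w, hw⟩ ⟨v, hv⟩
    exact ⟨w * v, fun i => by rw [Equiv.Perm.mul_apply, hw, hv, mul_assoc]⟩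
  inv_mem' := by
    rintro c ⟨w, hw⟩
    exact ⟨w⁻¹, fun i => by rw [eq_inv_mul_iff_mul_eq, ← hw, show w (w⁻¹ i) = i from w.apply_symm_apply i]⟩

/-- A nonvanishing Leibniz term of `det g` gives `w` with all `g (w i) i ≠ 0`. Cancelling these
entries yields `σ i = c * σ (w i)`, so `w` witnesses `c⁻¹`. -/
lemma mem_eigenShifts_of_mem_scaledCommutant {σ : Fin n → Kˣ} {c : Kˣ} {g : GL (Fin n) K}
    (hg : g ∈ scaledCommutant σ c) : c ∈ eigenShifts σ := by
  have hdet : (g : Matrix (Fin n) (Fin n) K).det ≠ 0 :=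
    ((Matrix.isUnit_iff_isUnit_det _).1 g.isUnit).ne_zero
  rw [Matrix.det_apply] at hdet
  obtain ⟨w, -, hw⟩ := Finset.exists_ne_zero_of_sum_ne_zero hdet
  have hw' : ∀ i, (g : Matrix (Fin n) (Fin n) K) (w i) i ≠ 0 := by
    intro i hi
    have h0 : ∏ j, (g : Matrix (Fin n) (Fin n) K) (w j) j = 0 :=
      Finset.prod_eq_zero (Finset.mem_univ i) hi
    exact hw (by rw [h0, smul_zero])
  rw [← inv_mem_iff]
  refine ⟨w, fun i => ?_⟩
  rw [eq_inv_mul_iff_mul_eq]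
  apply Units.ext
  have h := hg (w i) i
  rw [mul_comm] at h
  exact (mul_right_cancel₀ (hw' i) h).symm

lemma exists_mem_scaledCommutant {σ : Fin n → Kˣ} {c : Kˣ} (hc : c ∈ eigenShifts σ) :
    ∃ g, g ∈ scaledCommutant σ c := by
  rw [← inv_mem_iff] at hc
  obtain ⟨w, hw⟩ := hc
  have hdet : ((w⁻¹).permMatrix K).det ≠ 0 := by
    rw [Matrix.det_permutation]
    exact ((Equiv.Perm.sign w⁻¹).isUnit.map (Int.castRingHom K)).ne_zero
  obtain ⟨x, hx⟩ := (Matrix.isUnit_iff_isUnit_det _).2 (isUnit_iff_ne_zero.2 hdet)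
  refine ⟨x, fun i j => ?_⟩
  rw [hx]
  simp only [Equiv.Perm.permMatrix, PEquiv.toMatrix_apply,
    Equiv.toPEquiv_apply, Option.mem_def, Option.some.injEq]
  split_ifs with h
  · have h' : i = w j := by rw [← h, show w (w⁻¹ i) = i from w.apply_symm_apply i]
    rw [h', hw]
    simp
  · simp

lemma scaledCommutant_disjoint [NeZero n] {σ : Fin n → Kˣ} {c d : Kˣ} {g : GL (Fin n) K}
    (hc : g ∈ scaledCommutant σ c) (hd : g ∈ scaledCommutant σ d) : c = d := by
  obtain ⟨i, hi⟩ : ∃ i, (g : Matrix (Fin n) (Fin n) K) i 0 ≠ 0 := by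
    by_contra! H
    exact ((Matrix.isUnit_iff_isUnit_det _).1 g.isUnit).ne_zero (Matrix.det_eq_zero_of_column_eq_zero 0 H)
  have h := (hc i 0).symm.trans (hd i 0)
  exact Units.ext (mul_right_cancel₀ (σ i).ne_zero (mul_right_cancel₀ hi h))

/-- Each piece is stable under scalars, so it is the full preimage of its image. Closedness in the
quotient topology can therefore be checked in `GL_n`. -/
lemma mk_mem_image_scaledCommutant_iff {σ : Fin n → Kˣ} {c : Kˣ} {g : GL (Fin n) K} :
    ProjGenLinGroup.mk g ∈ ProjGenLinGroup.mk '' scaledCommutant σ c ↔ g ∈ scaledCommutant σ c := by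
  refine ⟨?_, fun h => ⟨g, h, rfl⟩⟩
  rintro ⟨h, hh, hhg⟩
  obtain ⟨u, rfl⟩ := ProjGenLinGroup.mk_eq_mk_iff.1 hhg
  simpa using mul_mem_scaledCommutant hh (scalar_mem_scaledCommutant σ u)

lemma mk_mem_centralizer_iff {σ : Fin n → Kˣ} {g : GL (Fin n) K} :
    ProjGenLinGroup.mk g ∈ Subgroup.centralizer {ProjGenLinGroup.mk (diagGL n K σ)} ↔
      ∃ c, g ∈ scaledCommutant σ c := by
  rw [Subgroup.mem_centralizer_singleton_iff, ← map_mul, ← map_mul, eq_comm,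
    ProjGenLinGroup.mk_eq_mk_iff]
  refine exists_congr fun c => ?_
  rw [mem_scaledCommutant_iff, ← Units.val_inj, eq_comm]
  have h1 : ((diagGL n K σ : GL (Fin n) K) : Matrix (Fin n) (Fin n) K) =
      diagonal fun i => (σ i : K) := rfl
  have h2 : ((GeneralLinearGroup.scalar (Fin n) c : GL (Fin n) K) : Matrix (Fin n) (Fin n) K) =
      (c : K) • (1 : Matrix (Fin n) (Fin n) K) := by
    ext i j
    simp [GeneralLinearGroup.scalar, Matrix.scalar_apply, Matrix.diagonal_apply, Matrix.one_apply]
  simp only [Units.val_mul, h1, h2, mul_smul_comm, mul_one]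

/-- The identity component of the centralizer of a diagonal element of `PGL_n`. -/
lemma centralizerComponent_mk_diagGL [Infinite K] [NeZero n] (σ : Fin n → Kˣ)
    (hfin : (eigenShifts σ : Set Kˣ).Finite) :
    centralizerComponent (ProjGenLinGroup.mk (diagGL n K σ)) =
      ProjGenLinGroup.mk '' scaledCommutant σ 1 := by
  let tG := zariskiGL n K
  let tP : TopologicalSpace PGL(n, K) := zariskiPGL n K
  set C : Set PGL(n, K) := (Subgroup.centralizer {ProjGenLinGroup.mk (diagGL n K σ)} : Set PGL(n, K))
    with hC
  have hsub : ProjGenLinGroup.mk '' scaledCommutant σ 1 ⊆ C := by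
    rintro _ ⟨g, hg, rfl⟩
    exact mk_mem_centralizer_iff.2 ⟨1, hg⟩
  have hclosed : ∀ c, IsClosed (ProjGenLinGroup.mk '' scaledCommutant σ c) := by
    intro c
    refine isClosed_coinduced.2 ?_
    convert isClosed_scaledCommutant σ c using 1
    ext g
    exact mk_mem_image_scaledCommutant_iff
  have h1 : (1 : PGL(n, K)) ∈ ProjGenLinGroup.mk '' scaledCommutant σ 1 :=
    ⟨1, one_mem_scaledCommutant σ, map_one _⟩
  change connectedComponentIn C 1 = _
  apply Set.Subset.antisymm
  -- The other pieces form a finite union of closed sets, so the piece `c = 1` is separated from the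
  -- rest of the centralizer.
  · set B : Set PGL(n, K) := ⋃ c ∈ (eigenShifts σ : Set Kˣ) \ {1},
      ProjGenLinGroup.mk '' scaledCommutant σ c with hB
    have hBclosed : IsClosed B := (hfin.subset Set.sdiff_subset).isClosed_biUnion fun c _ => hclosed c
    have hcover : C ⊆ ProjGenLinGroup.mk '' scaledCommutant σ 1 ∪ B := by
      intro x hx
      obtain ⟨g, rfl⟩ := ProjGenLinGroup.mk_surjective x
      obtain ⟨c, hc⟩ := mk_mem_centralizer_iff.1 hx
      by_cases h : c = 1
      · exact Or.inl ⟨g, h ▸ hc, rfl⟩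
      · exact Or.inr (Set.mem_biUnion ⟨mem_eigenShifts_of_mem_scaledCommutant hc, h⟩ ⟨g, hc, rfl⟩)
    have hdisj : ∀ x, x ∈ ProjGenLinGroup.mk '' scaledCommutant σ 1 → x ∉ B := by
      rintro _ ⟨g, hg, rfl⟩ hgB
      obtain ⟨c, hc, hcg⟩ := Set.mem_iUnion₂.1 hgB
      exact hc.2 (scaledCommutant_disjoint (mk_mem_image_scaledCommutant_iff.1 hcg) hg)
    intro x hx
    by_contra hxL
    have hsubC := connectedComponentIn_subset C (1 : PGL(n, K))
    obtain ⟨y, -, hy1, hyB⟩ := isPreconnected_closed_iff.1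
      (isPreconnected_connectedComponentIn (F := C) (x := (1 : PGL(n, K)))) _ _ (hclosed 1) hBclosed
      (hsubC.trans hcover) ⟨1, mem_connectedComponentIn (hsub h1), h1⟩
      ⟨x, hx, (hcover (hsubC hx)).resolve_left hxL⟩
    exact hdisj y hy1 hyB
  · refine IsPreconnected.subset_connectedComponentIn ?_ h1 hsub
    exact (isPreirreducible_scaledCommutant_one σ).isPreconnected.image _
      (continuous_coinduced_rng.continuousOn)

lemma smul_image_scaledCommutant {σ : Fin n → Kˣ} {c : Kˣ} {g : GL (Fin n) K}
    (hg : g ∈ scaledCommutant σ c) :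
    ProjGenLinGroup.mk g • (ProjGenLinGroup.mk '' scaledCommutant σ 1) =
      ProjGenLinGroup.mk '' scaledCommutant σ c := by
  ext x
  obtain ⟨h, rfl⟩ := ProjGenLinGroup.mk_surjective x
  rw [Set.mem_smul_set_iff_inv_smul_mem, smul_eq_mul, ← map_inv, ← map_mul,
    mk_mem_image_scaledCommutant_iff, mk_mem_image_scaledCommutant_iff]
  refine ⟨fun H => ?_, fun H => ?_⟩
  · simpa using mul_mem_scaledCommutant hg H
  · simpa using mul_mem_scaledCommutant (inv_mem_scaledCommutant hg) H

lemma map_mem_scaledCommutant {σ : Fin n → Kˣ} {c : Kˣ} {g : GL (Fin n) K} (φ : K →+* K)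
    (hσ : ∀ i, φ (σ i) = σ i) (hc : φ c = c) (hg : g ∈ scaledCommutant σ c) :
    GeneralLinearGroup.map φ g ∈ scaledCommutant σ c := by
  intro i j
  have h := congrArg φ (hg i j)
  simp only [map_mul, hσ, hc] at h
  exact h

/-- Every component of the centralizer of a rational diagonal element is Frobenius stable, and the
components are indexed by the scalars `c` with `c · diag(σ)` conjugate to `diag(σ)`. -/
lemma ncard_componentGroupFixed {p f : ℕ} [ExpChar K p] [Infinite K] [NeZero n] (σ : Fin n → Kˣ)
    (hfin : (eigenShifts σ : Set Kˣ).Finite) (hσ : ∀ i, (σ i : K) ^ p ^ f = σ i) :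
    (componentGroupFixed p f (ProjGenLinGroup.mk (diagGL n K σ))).ncard =
      Nat.card (eigenShifts σ) := by
  -- A shift is a quotient of two rational eigenvalues, hence rational; so Frobenius maps each piece
  -- to itself.
  have hc : ∀ c ∈ eigenShifts σ, (c : K) ^ p ^ f = c := by
    rintro c ⟨w, hw⟩
    have h : (c : K) = σ (w 0) / σ 0 := by rw [hw]; simp
    rw [h, div_pow, hσ, hσ]
  have himage : componentGroupFixed p f (ProjGenLinGroup.mk (diagGL n K σ)) =
      (fun c => ProjGenLinGroup.mk '' scaledCommutant σ c) '' (eigenShifts σ : Set Kˣ) := by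
    ext X
    simp only [componentGroupFixed, centralizerComponent_mk_diagGL σ hfin]
    constructor
    · rintro ⟨x, hx, rfl, -⟩
      obtain ⟨g, rfl⟩ := ProjGenLinGroup.mk_surjective x
      obtain ⟨c, hgc⟩ := mk_mem_centralizer_iff.1 hx
      exact ⟨c, mem_eigenShifts_of_mem_scaledCommutant hgc, (smul_image_scaledCommutant hgc).symm⟩
    · rintro ⟨c, hcU, rfl⟩
      obtain ⟨g, hg⟩ := exists_mem_scaledCommutant hcU
      refine ⟨ProjGenLinGroup.mk g, mk_mem_centralizer_iff.2 ⟨c, hg⟩,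
        (smul_image_scaledCommutant hg).symm, ?_⟩
      have hg' := map_mem_scaledCommutant (iterateFrobenius K p f)
        (fun i => by rw [iterateFrobenius_def, hσ]) (by rw [iterateFrobenius_def, hc c hcU]) hg
      exact (smul_image_scaledCommutant hg').symm
  rw [himage, Set.InjOn.ncard_image, ← Nat.card_coe_set_eq]
  · rfl
  · intro c hcU d hdU hcd
    obtain ⟨g, hg⟩ := exists_mem_scaledCommutant hcU
    have : ProjGenLinGroup.mk g ∈ ProjGenLinGroup.mk '' scaledCommutant σ d := by
      rw [← show _ = ProjGenLinGroup.mk '' scaledCommutant σ d from hcd]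
      exact ⟨g, hg, rfl⟩
    exact scaledCommutant_disjoint hg (mk_mem_image_scaledCommutant_iff.1 this)

end Component

/-! ### Monomial matrices, the torus normalizer and the extended Weyl group -/

section Monomial

variable {n : ℕ} {K : Type*} [Field K]

/-- The monomial matrix sending the `j`-th basis vector to `u j` times the `w j`-th one. -/
def monomialMatrix (w : Equiv.Perm (Fin n)) (u : Fin n → Kˣ) : Matrix (Fin n) (Fin n) K :=
  Matrix.of fun i j => if i = w j then (u j : K) else 0

lemma monomialMatrix_apply (w : Equiv.Perm (Fin n)) (u : Fin n → Kˣ) (i j : Fin n) :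
    monomialMatrix w u i j = if i = w j then (u j : K) else 0 := rfl

lemma monomialMatrix_mul (w w' : Equiv.Perm (Fin n)) (u u' : Fin n → Kˣ) :
    monomialMatrix w u * monomialMatrix w' u' =
      monomialMatrix (w * w') fun j => u (w' j) * u' j := by
  ext i j
  simp only [Matrix.mul_apply, monomialMatrix_apply, Equiv.Perm.mul_apply, mul_ite, mul_zero,
    Finset.sum_ite_eq', Finset.mem_univ, if_true, ite_mul, zero_mul, Units.val_mul]
  rfl

lemma monomialMatrix_inj {w w' : Equiv.Perm (Fin n)} {u u' : Fin n → Kˣ}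
    (h : monomialMatrix w u = monomialMatrix w' u') : w = w' ∧ u = u' := by
  have key : ∀ j, w j = w' j ∧ u j = u' j := by
    intro j
    have h1 := congrFun (congrFun h (w j)) j
    simp only [monomialMatrix_apply, if_true] at h1
    split_ifs at h1 with h2
    · exact ⟨h2, Units.ext h1⟩
    · exact absurd h1 (u j).ne_zero
  exact ⟨Equiv.ext fun j => (key j).1, funext fun j => (key j).2⟩

lemma monomialMatrix_one (d : Fin n → Kˣ) :
    monomialMatrix 1 d = diagonal fun i => (d i : K) := by
  ext i j
  rw [monomialMatrix_apply, Matrix.diagonal_apply, Equiv.Perm.one_apply]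
  by_cases h : i = j
  · rw [if_pos h, if_pos h, h]
  · rw [if_neg h, if_neg h]

lemma monomialMatrix_one_one : monomialMatrix 1 (1 : Fin n → Kˣ) = 1 := by
  rw [monomialMatrix_one]
  simp

lemma det_monomialMatrix (w : Equiv.Perm (Fin n)) (u : Fin n → Kˣ) :
    (monomialMatrix w u).det = ((Equiv.Perm.sign w : ℤ) : K) * ∏ i, (u i : K) := by
  have h : monomialMatrix w u = (w⁻¹).permMatrix K * diagonal fun i => (u i : K) := by
    ext i j
    simp only [monomialMatrix_apply, Matrix.mul_diagonal, Equiv.Perm.permMatrix,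
      PEquiv.toMatrix_apply, Equiv.toPEquiv_apply, Option.mem_def, Option.some.injEq, ite_mul,
      one_mul, zero_mul, Equiv.Perm.inv_eq_iff_eq]
  rw [h, Matrix.det_mul, Matrix.det_permutation, Matrix.det_diagonal, Equiv.Perm.sign_inv]

/-- The sign of a permutation as a unit of `K`. -/
def signUnit (K : Type*) [Field K] : Equiv.Perm (Fin n) →* Kˣ :=
  (Units.map (Int.castRingHom K).toMonoidHom).comp Equiv.Perm.sign

/-- Determinant one makes the product of entries inverse to the sign, which is its own inverse. This
is the source of the sign cocycle. -/
lemma prod_eq_signUnit {g : SL(n, K)} {w : Equiv.Perm (Fin n)} {u : Fin n → Kˣ}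
    (h : g.1 = monomialMatrix w u) : ∏ i, u i = signUnit K w := by
  have hdet := g.2
  rw [h, det_monomialMatrix] at hdet
  have h1 : signUnit K w * ∏ i, u i = 1 := by
    apply Units.ext
    simpa [signUnit] using hdet
  have h2 : signUnit K w * signUnit K w = 1 := by
    rw [signUnit, MonoidHom.comp_apply, ← map_mul, Int.units_mul_self, map_one]
  exact mul_left_cancel (h1.trans h2.symm)

lemma mem_torusSL_iff {g : SL(n, K)} : g ∈ torusSL n K ↔ ∃ d, g.1 = monomialMatrix 1 d := by
  refine exists_congr fun d => ?_
  rw [monomialMatrix_one, ← Units.val_inj, eq_comm]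
  rfl

lemma toGL_eq_diagGL_iff {g : SL(n, K)} {d : Fin n → Kˣ} :
    Matrix.SpecialLinearGroup.toGL g = diagGL n K d ↔ g.1 = monomialMatrix 1 d := by
  rw [monomialMatrix_one, ← Units.val_inj]
  rfl

lemma exists_SL_eq_diagonal {d : Fin n → Kˣ} (hd : ∏ i, d i = 1) :
    ∃ g : SL(n, K), g.1 = monomialMatrix 1 d := by
  refine ⟨⟨monomialMatrix 1 d, ?_⟩, rfl⟩
  rw [det_monomialMatrix, ← Units.coe_prod, hd]
  simp

lemma conj_eq_monomialMatrix {g t : SL(n, K)} {w : Equiv.Perm (Fin n)} {u d : Fin n → Kˣ}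
    (hg : g.1 = monomialMatrix w u) (ht : t.1 = monomialMatrix 1 d) :
    (g * t * g⁻¹).1 = monomialMatrix 1 fun i => d (w⁻¹ i) := by
  obtain ⟨t', ht'⟩ : ∃ t' : SL(n, K), t'.1 = monomialMatrix 1 fun i => d (w⁻¹ i) := by
    apply exists_SL_eq_diagonal
    rw [Equiv.prod_comp w⁻¹ d, prod_eq_signUnit ht, map_one]
  have h : g * t = t' * g := by
    apply Subtype.ext
    change g.1 * t.1 = t'.1 * g.1
    rw [hg, ht, ht', monomialMatrix_mul, monomialMatrix_mul, mul_one, one_mul]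
    congr 1
    funext j
    rw [show w⁻¹ (w j) = j from w.symm_apply_apply j, mul_comm]
    rfl
  rw [h, mul_inv_cancel_right, ht']

lemma inv_eq_monomialMatrix {g : SL(n, K)} {w : Equiv.Perm (Fin n)} {u : Fin n → Kˣ}
    (hg : g.1 = monomialMatrix w u) : ∃ u', (g⁻¹).1 = monomialMatrix w⁻¹ u' := by
  refine ⟨fun i => (u (w⁻¹ i))⁻¹, ?_⟩
  have h1 : monomialMatrix w⁻¹ (fun i => (u (w⁻¹ i))⁻¹) * g.1 = 1 := by
    rw [hg, monomialMatrix_mul, inv_mul_cancel, monomialMatrix_one]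
    simp
  have h2 : g.1 * (g⁻¹).1 = 1 := congrArg Subtype.val (mul_inv_cancel g)
  exact (left_inv_eq_right_inv h1 h2).symm

lemma mem_normalizer_torusSL_of_eq {g : SL(n, K)} {w : Equiv.Perm (Fin n)} {u : Fin n → Kˣ}
    (hg : g.1 = monomialMatrix w u) :
    g ∈ Subgroup.normalizer (torusSL n K : Set SL(n, K)) := by
  rw [Subgroup.mem_normalizer_iff]
  intro t
  simp only [mem_torusSL_iff]
  constructor
  · rintro ⟨d, hd⟩
    exact ⟨_, conj_eq_monomialMatrix hg hd⟩
  · rintro ⟨d, hd⟩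
    obtain ⟨u', hu'⟩ := inv_eq_monomialMatrix hg
    have := conj_eq_monomialMatrix hu' hd
    rw [inv_inv, show g⁻¹ * (g * t * g⁻¹) * g = t by group] at this
    exact ⟨_, this⟩

lemma exists_sq_ne_one [Infinite K] : ∃ x : Kˣ, x * x ≠ 1 := by
  by_contra! H
  have : (Polynomial.X ^ 3 - Polynomial.X : Polynomial K) = 0 := by
    refine Polynomial.funext fun t => ?_
    by_cases ht : t = 0
    · simp [ht]
    · have := congrArg Units.val (H (Units.mk0 t ht))
      simp only [Units.val_mul, Units.val_mk0, Units.val_one] at this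
      simp only [Polynomial.eval_sub, Polynomial.eval_pow, Polynomial.eval_X, Polynomial.eval_zero]
      linear_combination t * this
  have h3 := congrArg (Polynomial.coeff · 3) this
  simp [Polynomial.coeff_X] at h3

/-- Over an infinite field the normalizer of the diagonal torus consists of monomial matrices. -/
lemma exists_eq_monomialMatrix_of_mem_normalizer [Infinite K] {g : SL(n, K)}
    (hg : g ∈ Subgroup.normalizer (torusSL n K : Set SL(n, K))) :
    ∃ w u, g.1 = monomialMatrix w u := by
  obtain ⟨x, hx⟩ := exists_sq_ne_one (K := K)
  -- Two nonzero entries in one row would force the conjugate of `diag(…, x, …, x⁻¹, …)`, which is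
  -- diagonal, to have both `x` and `x⁻¹` as its entry in that row, against `x * x ≠ 1`.
  have hrow : ∀ k i j, g.1 k i ≠ 0 → g.1 k j ≠ 0 → i = j := by
    intro k i j hi hj
    by_contra hij
    obtain ⟨t, ht⟩ : ∃ t : SL(n, K), t.1 = monomialMatrix 1 (Pi.mulSingle i x * Pi.mulSingle j x⁻¹) := by
      apply exists_SL_eq_diagonal
      simp [Finset.prod_mul_distrib]
    obtain ⟨d, hd⟩ := mem_torusSL_iff.1 ((Subgroup.mem_normalizer_iff.1 hg t).1
      (mem_torusSL_iff.2 ⟨_, ht⟩))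
    have hmul : g.1 * t.1 = monomialMatrix 1 d * g.1 := by
      rw [← hd]
      exact congrArg Subtype.val (show g * t = g * t * g⁻¹ * g by group)
    rw [ht, monomialMatrix_one, monomialMatrix_one] at hmul
    have h1 := congrFun (congrFun hmul k) i
    have h2 := congrFun (congrFun hmul k) j
    rw [Matrix.mul_diagonal, Matrix.diagonal_mul, mul_comm] at h1 h2
    have h3 := (mul_right_cancel₀ hi h1).trans (mul_right_cancel₀ hj h2).symm
    simp only [Pi.mul_apply, Pi.mulSingle_eq_same, Pi.mulSingle_eq_of_ne hij,
      Pi.mulSingle_eq_of_ne (Ne.symm hij), mul_one, one_mul] at h3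
    exact hx (by nth_rewrite 1 [Units.ext h3]; exact inv_mul_cancel x)
  have hdet : g.1.det ≠ 0 := by rw [g.2]; exact one_ne_zero
  rw [Matrix.det_apply] at hdet
  obtain ⟨w, -, hw⟩ := Finset.exists_ne_zero_of_sum_ne_zero hdet
  have hw' : ∀ i, g.1 (w i) i ≠ 0 := by
    intro i hi
    have h0 : ∏ j, g.1 (w j) j = 0 := Finset.prod_eq_zero (Finset.mem_univ i) hi
    exact hw (by rw [h0, smul_zero])
  refine ⟨w, fun i => Units.mk0 _ (hw' i), ?_⟩
  ext i j
  rw [monomialMatrix_apply]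
  split_ifs with h
  · rw [h]; rfl
  · by_contra hne
    refine h ?_
    have h1 := hw' (w⁻¹ i)
    rw [show w (w⁻¹ i) = i from w.apply_symm_apply i] at h1
    rw [hrow i j (w⁻¹ i) hne h1, show w (w⁻¹ i) = i from w.apply_symm_apply i]

lemma rootWeylElt_eq {i j : Fin n} (hij : i ≠ j) :
    (rootWeylElt K hij).1 = monomialMatrix (Equiv.swap i j) (Function.update 1 i (-1)) := by
  have h : (rootWeylElt K hij).1 =
      1 + single i j 1 - single j i 1 - single i i 1 - (single j j 1 : Matrix (Fin n) (Fin n) K) := by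
    change (1 + single i j (1 : K)) * (1 + single j i (-1)) * (1 + single i j 1) = _
    have hneg : single j i (-1 : K) = - single j i 1 := by
      rw [← neg_one_mul, ← smul_eq_mul, ← Matrix.smul_single]; simp
    rw [hneg]
    simp only [mul_add, add_mul, one_mul, mul_one, mul_neg, neg_mul, Matrix.single_mul_single_same,
      Matrix.single_mul_single_of_ne _ _ _ _ hij.symm]
    abel
  rw [h]
  ext k l
  simp only [monomialMatrix_apply, Matrix.sub_apply, Matrix.add_apply, Matrix.single_apply,
    Matrix.one_apply, Function.update_apply, Pi.one_apply, Equiv.swap_apply_def]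
  by_cases hki : k = i <;> by_cases hkj : k = j <;> by_cases hli : l = i <;> by_cases hlj : l = j <;>
    by_cases hkl : k = l <;> simp_all <;> grind

/-- Elements of the extended Weyl group are signed permutation matrices. -/
lemma exists_eq_of_mem_extendedWeyl {v : SL(n, K)} (hv : v ∈ extendedWeyl n K) :
    ∃ w u, v.1 = monomialMatrix w u ∧ ∀ i, u i = 1 ∨ u i = -1 := by
  induction hv using Subgroup.closure_induction with
  | mem x hx =>
    obtain ⟨i, j, hij, rfl⟩ := hx
    refine ⟨_, _, rootWeylElt_eq hij, fun k => ?_⟩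
    by_cases h : k = i
    · subst h; simp
    · simp [Function.update_of_ne h]
  | one => exact ⟨1, 1, monomialMatrix_one_one.symm, by simp⟩
  | mul x y _ _ hx hy =>
    obtain ⟨w, u, h, hu⟩ := hx
    obtain ⟨w', u', h', hu'⟩ := hy
    refine ⟨w * w', _, by rw [← monomialMatrix_mul, ← h, ← h']; rfl, fun i => ?_⟩
    rcases hu (w' i) with e | e <;> rcases hu' i with e' | e' <;> simp [e, e']
  | inv x _ hx =>
    obtain ⟨w, u, h, hu⟩ := hx
    obtain ⟨u', h'⟩ := inv_eq_monomialMatrix h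
    refine ⟨_, u', h', fun i => ?_⟩
    have h1 : (x * x⁻¹).1 = monomialMatrix 1 1 := by
      rw [mul_inv_cancel, monomialMatrix_one_one]
      rfl
    have h2 := (monomialMatrix_inj ((show _ = x.1 * (x⁻¹).1 by rw [h, h', monomialMatrix_mul]).trans h1)).2
    have h3 := congrFun h2 i
    simp only [Pi.one_apply] at h3
    rcases hu (w⁻¹ i) with e | e
    · left; rwa [e, one_mul] at h3
    · right
      rw [e, neg_one_mul] at h3
      rw [← h3, neg_neg]

/-- The generators `n_α(1)` lie over the transpositions, which generate the symmetric group. -/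
lemma exists_mem_extendedWeyl (w : Equiv.Perm (Fin n)) :
    ∃ v ∈ extendedWeyl n K, ∃ u, v.1 = monomialMatrix w u := by
  induction w using Equiv.Perm.swap_induction_on with
  | one => exact ⟨1, one_mem _, 1, monomialMatrix_one_one.symm⟩
  | swap_mul w i j hij ih =>
    obtain ⟨v, hv, u, hu⟩ := ih
    refine ⟨rootWeylElt K hij * v, mul_mem (Subgroup.subset_closure ⟨i, j, hij, rfl⟩) hv,
      fun k => Function.update (1 : Fin n → Kˣ) i (-1) (w k) * u k, ?_⟩
    change (rootWeylElt K hij).1 * v.1 = _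
    rw [rootWeylElt_eq, hu]
    exact monomialMatrix_mul _ _ _ _

end Monomial

/-! ### Frobenius-fixed monomial matrices -/

section Rational

variable {p f n : ℕ} {K : Type*} [Field K] [ExpChar K p]

lemma mem_finiteSL_iff {g : SL(n, K)} {w : Equiv.Perm (Fin n)} {u : Fin n → Kˣ}
    (hg : g.1 = monomialMatrix w u) : g ∈ finiteSL p f n K ↔ ∀ i, u i ^ p ^ f = u i := by
  have h1 : (frobSL p f n K g).1 = monomialMatrix w fun i => u i ^ p ^ f := by
    ext i j
    change iterateFrobenius K p f (g.1 i j) = _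
    rw [hg, monomialMatrix_apply, monomialMatrix_apply]
    split_ifs
    · rw [iterateFrobenius_def, Units.val_pow_eq_pow_val]
    · rw [map_zero]
  change frobSL p f n K g = g ↔ _
  constructor
  · intro h i
    have h2 := congrArg Subtype.val h
    rw [h1, hg] at h2
    exact congrFun (monomialMatrix_inj h2).2 i
  · intro h
    apply Subtype.ext
    rw [h1, hg, funext h]

lemma mem_finiteTorus_iff {g : SL(n, K)} :
    g ∈ finiteTorus p f n K ↔ ∃ d, g.1 = monomialMatrix 1 d ∧ ∀ i, d i ^ p ^ f = d i := by
  constructor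
  · rintro ⟨h1, h2⟩
    obtain ⟨d, hd⟩ := mem_torusSL_iff.1 h1
    exact ⟨d, hd, (mem_finiteSL_iff hd).1 h2⟩
  · rintro ⟨d, hd, h⟩
    exact ⟨mem_torusSL_iff.2 ⟨d, hd⟩, (mem_finiteSL_iff hd).2 h⟩

lemma mem_finiteTorusNormalizer_iff [Infinite K] {g : SL(n, K)} :
    g ∈ finiteTorusNormalizer p f n K ↔
      ∃ w u, g.1 = monomialMatrix w u ∧ ∀ i, u i ^ p ^ f = u i := by
  constructor
  · rintro ⟨h1, h2⟩
    obtain ⟨w, u, h⟩ := exists_eq_monomialMatrix_of_mem_normalizer h1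
    exact ⟨w, u, h, (mem_finiteSL_iff h).1 h2⟩
  · rintro ⟨w, u, h, h'⟩
    exact ⟨mem_normalizer_torusSL_of_eq h, (mem_finiteSL_iff h).2 h'⟩

lemma conj_mem_finiteTorus_iff {g : SL(n, K)} {w : Equiv.Perm (Fin n)} {u : Fin n → Kˣ}
    (hg : g.1 = monomialMatrix w u) (t : SL(n, K)) :
    t ∈ finiteTorus p f n K ↔ g * t * g⁻¹ ∈ finiteTorus p f n K := by
  simp only [mem_finiteTorus_iff]
  constructor
  · rintro ⟨d, hd, h⟩
    exact ⟨_, conj_eq_monomialMatrix hg hd, fun i => h _⟩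
  · rintro ⟨d, hd, h⟩
    obtain ⟨u', hu'⟩ := inv_eq_monomialMatrix hg
    have := conj_eq_monomialMatrix hu' hd
    rw [inv_inv, show g⁻¹ * (g * t * g⁻¹) * g = t by group] at this
    exact ⟨_, this, fun i => h _⟩

end Rational

/-! ### Signs on a half and the coboundary -/

section Permutations

variable {α : Type*} [Fintype α] [DecidableEq α]

/-- The sign of a fixed-point-free involution. -/
lemma sign_of_fixedPointFree_involution {w : Equiv.Perm α} (hw : w * w = 1) (hfix : ∀ i, w i ≠ i) :
    Equiv.Perm.sign w = (-1) ^ (Fintype.card α / 2) := by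
  have hct : w.cycleType = Multiset.replicate (Multiset.card w.cycleType) 2 := by
    refine Multiset.eq_replicate_card.2 fun m hm => le_antisymm ?_ (Equiv.Perm.two_le_of_mem_cycleType hm)
    exact Nat.le_of_dvd two_pos ((Equiv.Perm.dvd_of_mem_cycleType hm).trans
      (orderOf_dvd_of_pow_eq_one (by rw [pow_two, hw])))
  have hsum := w.sum_cycleType
  have hsupp : w.support = Finset.univ := by
    ext i
    simpa using hfix i
  rw [hsupp, Finset.card_univ, hct, Multiset.sum_replicate, smul_eq_mul] at hsum
  rw [Equiv.Perm.sign_of_cycleType, hct, Multiset.sum_replicate, Multiset.card_replicate, smul_eq_mul,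
    ← hsum, Nat.mul_div_cancel _ two_pos, pow_add, pow_mul', Int.units_sq, one_pow, one_mul]

/-- The sign of the restriction of a permutation to a subset that it preserves. -/
def restrictedSign (B : α → Prop) [DecidablePred B] (x : Equiv.Perm α) : ℤˣ :=
  if h : ∀ i, B (x i) ↔ B i then Equiv.Perm.sign (x.subtypePerm h) else 1

variable {B : α → Prop} [DecidablePred B]

lemma restrictedSign_of {x : Equiv.Perm α} (h : ∀ i, B (x i) ↔ B i) :
    restrictedSign B x = Equiv.Perm.sign (x.subtypePerm h) := dif_pos h

lemma restrictedSign_mul {x y : Equiv.Perm α} (hx : ∀ i, B (x i) ↔ B i) (hy : ∀ i, B (y i) ↔ B i) :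
    restrictedSign B (x * y) = restrictedSign B x * restrictedSign B y := by
  rw [restrictedSign_of hx, restrictedSign_of hy,
    restrictedSign_of (fun i => (hx (y i)).trans (hy i)), ← Equiv.Perm.sign_mul]
  rfl

lemma restrictedSign_mul_compl {x : Equiv.Perm α} (hx : ∀ i, B (x i) ↔ B i) :
    restrictedSign B x * restrictedSign (fun i => ¬ B i) x = Equiv.Perm.sign x := by
  rw [restrictedSign_of hx, restrictedSign_of (B := fun i => ¬ B i) (fun i => not_congr (hx i)),
    ← Equiv.Perm.sign_subtypeCongr]
  congr 1
  ext i
  by_cases h : B i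
  · rw [Equiv.Perm.subtypeCongr.left_apply _ _ h]; rfl
  · rw [Equiv.Perm.subtypeCongr.right_apply _ _ h]; rfl

/-- Conjugation by a swap `t` transports the action on the complement to the action on `B`, and sign
is invariant under such relabelling. -/
lemma restrictedSign_conj {x t : Equiv.Perm α} (hx : ∀ i, B (x i) ↔ B i)
    (ht : ∀ i, B (t i) ↔ ¬ B i) :
    restrictedSign B (t⁻¹ * x * t) = restrictedSign (fun i => ¬ B i) x := by
  have ht' : ∀ i, B (t⁻¹ i) ↔ ¬ B i := fun i => by
    rw [← not_iff_not, ← ht, show t (t⁻¹ i) = i from t.apply_symm_apply i, not_not]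
  have h : ∀ i, B ((t⁻¹ * x * t) i) ↔ B i := fun i => by
    rw [Equiv.Perm.mul_apply, Equiv.Perm.mul_apply, ht', hx, ht, not_not]
  rw [restrictedSign_of h, restrictedSign_of (B := fun i => ¬ B i) (fun i => not_congr (hx i)),
    ← Equiv.Perm.sign_permCongr (t.subtypeEquiv (fun i => by rw [ht, not_not]) :
      {i // B i} ≃ {i // ¬ B i})]
  congr 1
  ext i
  change t (t⁻¹ (x (t (t⁻¹ i)))) = x i
  simp

/-- If a permutation `w` swaps `B` and its complement, then so does an involution that agrees with
`w` on `B` and with `w⁻¹` elsewhere. -/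
lemma exists_swapping_involution {α : Type*} {B : α → Prop} [DecidablePred B] {w : Equiv.Perm α} (hw : ∀ i, B (w i) ↔ ¬ B i) :
    ∃ t : Equiv.Perm α, t * t = 1 ∧ (∀ i, B (t i) ↔ ¬ B i) ∧ ∀ i, t i = w i ∨ w (t i) = i := by
  have hw' : ∀ i, B (w⁻¹ i) ↔ ¬ B i := fun i => by
    rw [← not_iff_not, ← hw, show w (w⁻¹ i) = i from w.apply_symm_apply i, not_not]
  have hinv : Function.Involutive fun i => if B i then w i else w⁻¹ i := by
    intro i
    by_cases h : B i
    · simp [h, hw]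
    · simp only [h, if_false, (hw' i).2 h, if_true]
      exact w.apply_symm_apply i
  refine ⟨hinv.toPerm, Equiv.ext hinv, fun i => ?_, fun i => ?_⟩
  · change B (if B i then w i else w⁻¹ i) ↔ _
    by_cases h : B i
    · rw [if_pos h, hw]
    · rw [if_neg h, hw']
  · change (if B i then w i else w⁻¹ i) = w i ∨ w (if B i then w i else w⁻¹ i) = i
    by_cases h : B i
    · rw [if_pos h]
      exact Or.inl rfl
    · rw [if_neg h]
      exact Or.inr (w.apply_symm_apply i)

/-- On the permutations preserving or swapping two complementary halves of even size, the cocycle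
`(w', w) ↦ sign w` if `w'` swaps, and `1` otherwise, is a coboundary. -/
lemma exists_sign_coboundary (h4 : 4 ∣ Fintype.card α) {w₀ : Equiv.Perm α}
    (hw₀ : ∀ i, B (w₀ i) ↔ ¬ B i) :
    ∃ h : Equiv.Perm α → ℤˣ, ∀ w' w : Equiv.Perm α,
      ((∀ i, B (w i) ↔ B i) ∨ (∀ i, B (w i) ↔ ¬ B i)) →
      ((∀ i, B (w' i) ↔ B i) → h (w' * w) = h w' * h w) ∧
      ((∀ i, B (w' i) ↔ ¬ B i) → h (w' * w) = h w' * h w * Equiv.Perm.sign w) := by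
  obtain ⟨t, ht2, ht, -⟩ := exists_swapping_involution hw₀
  -- The divisibility by 4 enters here: `t` is a product of an even number of transpositions.
  have hsign : Equiv.Perm.sign t = 1 := by
    rw [sign_of_fixedPointFree_involution ht2 fun i hi => by have := ht i; rw [hi] at this; tauto]
    obtain ⟨k, hk⟩ := h4
    rw [hk, show 4 * k / 2 = 2 * k by omega, pow_mul, Int.units_sq, one_pow]
  have htinv : t⁻¹ = t := inv_eq_of_mul_eq_one_left ht2
  -- Swapping permutations are brought back to preserving ones by the fixed swap `t`.
  let h : Equiv.Perm α → ℤˣ := fun w =>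
    if ∀ i, B (w i) ↔ B i then restrictedSign B w else restrictedSign B (w * t)
  have hpres : ∀ w : Equiv.Perm α, (∀ i, B (w i) ↔ B i) → h w = restrictedSign B w :=
    fun w hw => if_pos hw
  have hswap : ∀ w : Equiv.Perm α, (∀ i, B (w i) ↔ ¬ B i) → h w = restrictedSign B (w * t) := by
    intro w hw
    -- On the empty type preserving and swapping coincide, and the first branch of `h` applies.
    cases isEmpty_or_nonempty α
    · simp only [h, Subsingleton.elim (w * t) w, ite_self]
    · refine if_neg fun H => ?_
      have i := Classical.arbitrary α
      have h1 := H i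
      have h2 := hw i
      tauto
  have hst : ∀ w : Equiv.Perm α, (∀ i, B (w i) ↔ ¬ B i) → ∀ i, B ((w * t) i) ↔ B i :=
    fun w hw i => by rw [Equiv.Perm.mul_apply, hw, ht, not_not]
  -- Moving `t` past `x` exchanges the signs on the two halves, whose ratio is `sign x`: this is the
  -- required cocycle.
  have hconj : ∀ x : Equiv.Perm α, (∀ i, B (x i) ↔ B i) →
      restrictedSign B (t * x * t) = restrictedSign B x * Equiv.Perm.sign x := by
    intro x hx
    nth_rewrite 1 [← htinv]
    rw [restrictedSign_conj hx ht, ← restrictedSign_mul_compl hx, ← mul_assoc, Int.units_mul_self,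
      one_mul]
  have hconj_pres : ∀ x : Equiv.Perm α, (∀ i, B (x i) ↔ B i) → ∀ i, B ((t * x * t) i) ↔ B i :=
    fun x hx i => by rw [Equiv.Perm.mul_apply, Equiv.Perm.mul_apply, ht, hx, ht, not_not]
  refine ⟨h, fun w' w hw => ⟨fun hw' => ?_, fun hw' => ?_⟩⟩
  · rcases hw with hw | hw
    · rw [hpres w' hw', hpres w hw, hpres _ fun i => (hw' (w i)).trans (hw i),
        restrictedSign_mul hw' hw]
    · rw [hpres w' hw', hswap w hw, hswap _ fun i => (hw' (w i)).trans (hw i), mul_assoc,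
        restrictedSign_mul hw' (hst w hw)]
  · rcases hw with hw | hw
    · rw [hswap w' hw', hpres w hw, hswap _ fun i => (hw' (w i)).trans (not_congr (hw i)),
        show w' * w * t = (w' * t) * (t * w * t) by
          rw [mul_assoc t, ← mul_assoc (w' * t), mul_assoc w' t t, ht2, mul_one, mul_assoc],
        restrictedSign_mul (hst w' hw') (hconj_pres w hw), hconj w hw, mul_assoc]
    · rw [hswap w' hw', hswap w hw,
        hpres _ fun i => (hw' (w i)).trans ((not_congr (hw i)).trans not_not),
        show w' * w = (w' * t) * (t * (w * t) * t) by
          rw [mul_assoc t, mul_assoc w t t, ht2, mul_one, ← mul_assoc (w' * t), mul_assoc w' t t, ht2,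
            mul_one],
        restrictedSign_mul (hst w' hw') (hconj_pres _ (hst w hw)), hconj _ (hst w hw),
        Equiv.Perm.sign_mul, hsign, mul_one, mul_assoc]

end Permutations

/-! ### Characters of degree one -/

section LinearCharacters

variable {X : Type*} [Group X]

lemma isIrrChar_of_monoidHom (χ : X →* ℂˣ) : IsIrrChar fun x => (χ x : ℂ) := by
  let ρ : Representation ℂ X (Fin 1 → ℂ) :=
    { toFun := fun x => (χ x : ℂ) • (1 : (Fin 1 → ℂ) →ₗ[ℂ] (Fin 1 → ℂ))
      map_one' := by simp
      map_mul' := fun x y => by rw [smul_mul_smul_comm, one_mul, map_mul, Units.val_mul] }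
  refine ⟨1, ρ, ?_, ?_⟩
  · have hsimple : IsSimpleModule ℂ (Fin 1 → ℂ) :=
      isSimpleModule_iff_finrank_eq_one.2 (by simp)
    refine { exists_pair_ne := ⟨⊥, ⊤, fun h => ?_⟩, eq_bot_or_eq_top := fun W => ?_ }
    · exact bot_ne_top (α := Submodule ℂ (Fin 1 → ℂ)) (congrArg Subrepresentation.toSubmodule h)
    · rcases eq_bot_or_eq_top W.toSubmodule with h | h
      · exact Or.inl (Subrepresentation.toSubmodule_injective h)
      · exact Or.inr (Subrepresentation.toSubmodule_injective h)
  · funext x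
    change (χ x : ℂ) = LinearMap.trace ℂ _ ((χ x : ℂ) • (1 : (Fin 1 → ℂ) →ₗ[ℂ] (Fin 1 → ℂ)))
    rw [map_smul, LinearMap.trace_one]
    simp

/-- The value at `1` is the degree, and endomorphisms of a line are scalars equal to their trace. -/
lemma IsIrrChar.map_mul_of_map_one {χ : X → ℂ} (hχ : IsIrrChar χ) (h1 : χ 1 = 1) (x y : X) :
    χ (x * y) = χ x * χ y := by
  obtain ⟨d, ρ, -, rfl⟩ := hχ
  have hd : d = 1 := by
    have : ρ.character 1 = d := by simp [Representation.character]
    exact_mod_cast this.symm.trans h1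
  subst hd
  have key : ∀ φ : (Fin 1 → ℂ) →ₗ[ℂ] (Fin 1 → ℂ), φ = LinearMap.trace ℂ _ φ • 1 := by
    intro φ
    have h : φ = (φ (Pi.single 0 1) 0) • 1 := by
      ext i j
      fin_cases i; fin_cases j
      simp
    have htr : LinearMap.trace ℂ _ φ = φ (Pi.single 0 1) 0 := by
      conv_lhs => rw [h]
      rw [map_smul, LinearMap.trace_one]
      simp
    rw [htr]
    exact h
  change LinearMap.trace ℂ _ (ρ (x * y)) = LinearMap.trace ℂ _ (ρ x) * LinearMap.trace ℂ _ (ρ y)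
  rw [map_mul]
  conv_lhs => rw [key (ρ x), key (ρ y)]
  rw [smul_mul_smul_comm, one_mul, map_smul, LinearMap.trace_one]
  simp

end LinearCharacters

/-! ### Stabilizers of torus characters and the extension formula -/

section Stabilizer

variable {p f n : ℕ} {K : Type*} [Field K] [ExpChar K p]

lemma exists_zpow_of_pow_eq_self {q : ℕ} (hq : 1 < q) {ζ x : Kˣ} (hζ : orderOf ζ = q - 1)
    (hx : x ^ q = x) : ∃ k : ℤ, ζ ^ k = x := by
  have : NeZero (q - 1) := ⟨by omega⟩
  have hprim : IsPrimitiveRoot ζ (q - 1) := hζ ▸ IsPrimitiveRoot.orderOf ζ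
  have hmem : x ∈ rootsOfUnity (q - 1) K := by
    rw [mem_rootsOfUnity]
    apply mul_right_cancel (b := x)
    rw [← pow_succ, Nat.sub_add_cancel hq.le, hx, one_mul]
  rw [← hprim.zpowers_eq] at hmem
  exact hmem

lemma zpow_pow_eq_self {q : ℕ} (hq : 1 < q) {ζ : Kˣ} (hζ : orderOf ζ = q - 1) (k : ℤ) :
    (ζ ^ k) ^ q = ζ ^ k := by
  have h : ζ ^ q = ζ := by
    conv_lhs => rw [← Nat.sub_add_cancel hq.le, pow_succ, ← hζ, pow_orderOf_eq_one, one_mul]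
  rw [← zpow_natCast, ← _root_.zpow_mul, mul_comm, _root_.zpow_mul, zpow_natCast, h]

/-- Every element of `F_q` other than zero is a power of `ζ`, so exponents matter only through their
effect on `ζ`. Equalities of powers of `ζ` thus serve as congruences modulo `q - 1`. -/
lemma zpow_congr_of_pow_eq_self {q : ℕ} (hq : 1 < q) {ζ x : Kˣ} (hζ : orderOf ζ = q - 1)
    (hx : x ^ q = x) {m m' : ℤ} (h : ζ ^ m = ζ ^ m') : x ^ m = x ^ m' := by
  obtain ⟨k, rfl⟩ := exists_zpow_of_pow_eq_self hq hζ hx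
  rw [← _root_.zpow_mul, mul_comm, _root_.zpow_mul, h, ← _root_.zpow_mul, mul_comm, _root_.zpow_mul]

/-- The character of the torus with exponent vector `a` is stabilized by a monomial matrix
precisely when the underlying permutation translates `a` modulo `q - 1`. -/
lemma mem_charStabilizer_finiteTorus_iff (hq : 1 < p ^ f) {κ : Kˣ →* ℂˣ}
    (hκ : Function.Injective κ) {ζ : Kˣ} (hζ : orderOf ζ = p ^ f - 1)
    {lam : finiteTorus p f n K → ℂ} {a : Fin n → ℤ}
    (hlam : ∀ (t : finiteTorus p f n K) (d : Fin n → Kˣ), t.1.1 = monomialMatrix 1 d →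
      lam t = ((∏ i, κ (d i) ^ a i : ℂˣ) : ℂ))
    (Y : Subgroup SL(n, K)) {g : SL(n, K)} {w : Equiv.Perm (Fin n)} {u : Fin n → Kˣ}
    (hg : g.1 = monomialMatrix w u) :
    g ∈ charStabilizer Y (finiteTorus p f n K) lam ↔
      g ∈ Y ∧ ∃ e : ℤ, ∀ i, ζ ^ a (w i) = ζ ^ (e + a i) := by
  have hconj : ∀ (t : finiteTorus p f n K) (d : Fin n → Kˣ), t.1.1 = monomialMatrix 1 d →
      lam ⟨g * t * g⁻¹, (conj_mem_finiteTorus_iff hg t).1 t.2⟩ =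
        ((∏ i, κ (d i) ^ a (w i) : ℂˣ) : ℂ) := by
    intro t d hd
    rw [hlam _ _ (conj_eq_monomialMatrix hg hd)]
    congr 1
    rw [← Equiv.prod_comp w]
    refine Finset.prod_congr rfl fun i _ => ?_
    rw [show w⁻¹ (w i) = i from w.symm_apply_apply i]
  constructor
  · rintro ⟨hY, _, hinv⟩
    refine ⟨hY, ?_⟩
    -- Testing on the torus element with entries `ζ` at `i` and `ζ⁻¹` at `j` isolates the difference
    -- of two exponents; injectivity of `κ` brings the relation back to `K`.
    have key : ∀ i j, ζ ^ a (w i) * ζ ^ a j = ζ ^ a (w j) * ζ ^ a i := by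
      intro i j
      by_cases hij : i = j
      · rw [hij]
      obtain ⟨t, ht⟩ : ∃ t : SL(n, K),
          t.1 = monomialMatrix 1 (Pi.mulSingle i ζ * Pi.mulSingle j ζ⁻¹) := by
        apply exists_SL_eq_diagonal
        simp [Finset.prod_mul_distrib]
      have hζq : ζ ^ p ^ f = ζ := by simpa using zpow_pow_eq_self hq hζ 1
      have htT : t ∈ finiteTorus p f n K := by
        refine mem_finiteTorus_iff.2 ⟨_, ht, fun k => ?_⟩
        simp only [Pi.mul_apply, Pi.mulSingle_apply]
        split_ifs <;> simp [hζq]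
      have h1 := (hconj ⟨t, htT⟩ _ ht).symm.trans ((hinv ⟨t, htT⟩).trans (hlam ⟨t, htT⟩ _ ht))
      have hprod : ∀ b : Fin n → ℤ, ∏ k, κ ((Pi.mulSingle i ζ * Pi.mulSingle j ζ⁻¹ : Fin n → Kˣ) k) ^ b k =
          κ (ζ ^ b i * (ζ ^ b j)⁻¹) := by
        intro b
        have h2 : ∀ k, κ ((Pi.mulSingle i ζ * Pi.mulSingle j ζ⁻¹ : Fin n → Kˣ) k) ^ b k =
            (if k = i then κ (ζ ^ b i) else 1) * (if k = j then κ ((ζ ^ b j)⁻¹) else 1) := by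
          intro k
          simp only [Pi.mul_apply, Pi.mulSingle_apply, map_mul, _root_.mul_zpow]
          congr 1
          · split_ifs with h
            · rw [h, map_zpow]
            · simp
          · split_ifs with h
            · rw [h, map_inv, map_inv, map_zpow, _root_.inv_zpow]
            · simp
        rw [Finset.prod_congr rfl fun k _ => h2 k, Finset.prod_mul_distrib]
        simp
      have h3 := Units.ext h1
      rw [hprod fun k => a (w k), hprod a] at h3
      have h4 := hκ h3
      rwa [← div_eq_mul_inv, ← div_eq_mul_inv, div_eq_div_iff_mul_eq_mul, mul_comm (ζ ^ a i)] at h4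
    rcases isEmpty_or_nonempty (Fin n) with h | ⟨⟨k⟩⟩
    · exact ⟨0, fun i => (h.false i).elim⟩
    · refine ⟨a (w k) - a k, fun i => ?_⟩
      rw [_root_.zpow_add, _root_.zpow_sub, mul_right_comm, ← key i k, mul_inv_cancel_right]
  · rintro ⟨hY, e, he⟩
    refine ⟨hY, conj_mem_finiteTorus_iff hg, fun t => ?_⟩
    obtain ⟨d, hd, hdq⟩ := mem_finiteTorus_iff.1 t.2
    rw [hconj t d hd, hlam t d hd]
    congr 1
    -- A constant shift of the exponents contributes `κ(∏ d i) ^ e`, which is `1` on `SL_n`.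
    have h1 : ∀ i, κ (d i) ^ a (w i) = κ (d i) ^ e * κ (d i) ^ a i := fun i => by
      rw [← map_zpow, zpow_congr_of_pow_eq_self hq hζ (hdq i) (he i), map_zpow, _root_.zpow_add]
    rw [Finset.prod_congr rfl fun i _ => h1 i, Finset.prod_mul_distrib, Finset.prod_zpow,
      ← map_prod, prod_eq_signUnit hd, map_one, map_one, _root_.one_zpow, one_mul]

/-- A character of the torus extends to its stabilizer, with values `±1` on signed permutation
matrices, as soon as a suitable sign cocycle on permutations is a coboundary. -/
lemma exists_rational_extension [Infinite K] (hq : 1 < p ^ f) {κ : Kˣ →* ℂˣ}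
    (hκ : Function.Injective κ) {ζ : Kˣ} (hζ : orderOf ζ = p ^ f - 1)
    {lam : finiteTorus p f n K → ℂ} {a : Fin n → ℤ}
    (hlam : ∀ (t : finiteTorus p f n K) (d : Fin n → Kˣ), t.1.1 = monomialMatrix 1 d →
      lam t = ((∏ i, κ (d i) ^ a i : ℂˣ) : ℂ))
    (h : Equiv.Perm (Fin n) → ℂˣ) (hsign : ∀ w, h w = 1 ∨ h w = -1)
    (hcob : ∀ (w w' : Equiv.Perm (Fin n)) (e e' : ℤ), (∀ i, ζ ^ a (w i) = ζ ^ (e + a i)) →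
      (∀ i, ζ ^ a (w' i) = ζ ^ (e' + a i)) →
      h (w' * w) = h w' * h w * κ (signUnit K w) ^ e') :
    ∃ lamHat : torusNormalizerStabilizer lam → ℂ, IsIrrChar lamHat ∧
      (∀ (x : torusNormalizerStabilizer lam) (hx : x.1 ∈ finiteTorus p f n K),
        lamHat x = lam ⟨x.1, hx⟩) ∧
      ∀ x : torusNormalizerStabilizer lam, x.1 ∈ extendedWeylStabilizer lam →
        ∃ r : ℚ, lamHat x = (r : ℂ) := by
  have hmono : ∀ x : torusNormalizerStabilizer lam, ∃ w u, x.1.1 = monomialMatrix w u ∧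
      (∀ i, u i ^ p ^ f = u i) ∧ ∃ e : ℤ, ∀ i, ζ ^ a (w i) = ζ ^ (e + a i) := by
    intro x
    obtain ⟨w, u, hx, hu⟩ := mem_finiteTorusNormalizer_iff.1 x.2.1
    exact ⟨w, u, hx, hu, ((mem_charStabilizer_finiteTorus_iff hq hκ hζ hlam _ hx).1 x.2).2⟩
  choose W U hWU hU E hE using hmono
  have h1 : h 1 = 1 := by
    have := hcob 1 1 0 0 (by simp) (by simp)
    rw [zpow_zero, mul_one, mul_one] at this
    exact (mul_eq_left.1 this.symm)
  let F : torusNormalizerStabilizer lam → ℂˣ :=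
    fun x => (∏ i, κ (U x i) ^ a (W x i)) * h (W x)
  have hF : ∀ (x : torusNormalizerStabilizer lam) (w : Equiv.Perm (Fin n)) (u : Fin n → Kˣ),
      x.1.1 = monomialMatrix w u → F x = (∏ i, κ (u i) ^ a (w i)) * h w := by
    intro x w u hx
    obtain ⟨rfl, rfl⟩ := monomialMatrix_inj (hx.symm.trans (hWU x))
    rfl
  have hFmul : ∀ x y, F (x * y) = F x * F y := by
    intro x y
    have hxy : (x * y).1.1 = monomialMatrix (W x * W y) fun j => U x (W y j) * U y j := by
      rw [← monomialMatrix_mul, ← hWU, ← hWU]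
      rfl
    rw [hF _ _ _ hxy, hcob _ _ _ _ (hE y) (hE x)]
    have hterm : ∀ i, κ (U x (W y i) * U y i) ^ a ((W x * W y) i) =
        κ (U x (W y i)) ^ a (W x (W y i)) * (κ (U y i) ^ E x * κ (U y i) ^ a (W y i)) := by
      intro i
      rw [map_mul, _root_.mul_zpow, Equiv.Perm.mul_apply, ← map_zpow κ (U y i),
        zpow_congr_of_pow_eq_self hq hζ (hU y i) (hE x (W y i)), map_zpow, _root_.zpow_add]
    -- One sign factor comes from the shifted exponents through `∏ U y i`, the other from `h`; they
    -- cancel.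
    have hsq : κ (signUnit K (W y)) ^ E x * κ (signUnit K (W y)) ^ E x = 1 := by
      rw [← _root_.mul_zpow, ← map_mul, ← map_mul, signUnit, MonoidHom.comp_apply, map_mul,
        Int.units_mul_self, map_one, map_one, _root_.one_zpow]
    rw [Finset.prod_congr rfl fun i _ => hterm i, Finset.prod_mul_distrib, Finset.prod_mul_distrib,
      Equiv.prod_comp (W y) fun j => κ (U x j) ^ a (W x j), Finset.prod_zpow, ← map_prod,
      prod_eq_signUnit (hWU y)]
    calc _ = (∏ i, κ (U x i) ^ a (W x i)) * h (W x) * ((∏ i, κ (U y i) ^ a (W y i)) * h (W y)) *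
          (κ (signUnit K (W y)) ^ E x * κ (signUnit K (W y)) ^ E x) := by ac_rfl
      _ = _ := by rw [hsq, mul_one]
  have hFone : F 1 = 1 := by
    have := hFmul 1 1
    rw [mul_one] at this
    exact mul_eq_left.1 this.symm
  refine ⟨fun x => (F x : ℂ), isIrrChar_of_monoidHom ⟨⟨F, hFone⟩, hFmul⟩, fun x hx => ?_, fun x hx => ?_⟩
  · obtain ⟨d, hd, -⟩ := mem_finiteTorus_iff.1 hx
    change (F x : ℂ) = _
    rw [hlam ⟨x.1, hx⟩ d hd, hF x 1 d hd, h1, mul_one]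
    rfl
  · obtain ⟨w, u, hwu, hu⟩ := exists_eq_of_mem_extendedWeyl hx.1
    -- On `V` the entries are `±1`, as are the values of `h`, so `F x` is `±1`.
    have hFsq : F x * F x = 1 := by
      have hu2 : ∀ i, κ (u i) ^ a (w i) * κ (u i) ^ a (w i) = 1 := by
        intro i
        rw [← _root_.mul_zpow, ← map_mul]
        rcases hu i with e | e <;> simp [e]
      have hh2 : h w * h w = 1 := by
        rcases hsign w with e | e <;> simp [e]
      rw [hF x w u hwu, mul_mul_mul_comm, hh2, ← Finset.prod_mul_distrib,
        Finset.prod_congr rfl fun i _ => hu2 i, Finset.prod_const_one, mul_one]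
    rcases mul_self_eq_one_iff.1 (congrArg Units.val hFsq : (F x : ℂ) * F x = 1) with e | e
    · exact ⟨1, e.trans (by simp)⟩
    · exact ⟨-1, e.trans (by simp)⟩

end Stabilizer

/-! ### The obstruction `λ(v²) = -1` -/

section Obstruction

variable {p f n : ℕ} {K : Type*} [Field K] [ExpChar K p]

lemma signUnit_eq_of_sign_eq_neg_one {w : Equiv.Perm (Fin n)} (hw : Equiv.Perm.sign w = -1) :
    signUnit K w = -1 := by
  apply Units.ext
  simp [signUnit, hw]

lemma signUnit_eq_of_sign_eq_one {w : Equiv.Perm (Fin n)} (hw : Equiv.Perm.sign w = 1) :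
    signUnit K w = 1 := by
  simp [signUnit, hw]

lemma map_neg_one_of_injective (h2 : (-1 : Kˣ) ≠ 1) {κ : Kˣ →* ℂˣ} (hκ : Function.Injective κ) :
    κ (-1) = -1 := by
  have h1 : κ (-1) * κ (-1) = 1 := by rw [← map_mul]; simp
  have h3 : κ (-1) ≠ 1 := fun h => h2 (hκ (h.trans (map_one κ).symm))
  rcases mul_self_eq_one_iff.1 (congrArg Units.val h1 : (κ (-1) : ℂ) * κ (-1) = 1) with e | e
  · exact absurd (Units.ext e) h3
  · exact Units.ext e

/-- Congruent exponents of a generator of even order have the same parity. -/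
lemma odd_iff_odd_of_zpow_eq {ζ : Kˣ} (h2 : 2 ∣ orderOf ζ) {x y : ℤ} (h : ζ ^ x = ζ ^ y) :
    Odd x ↔ Odd y := by
  rw [zpow_eq_zpow_iff_modEq] at h
  have h' : x ≡ y [ZMOD 2] := h.of_dvd (by exact_mod_cast h2)
  rw [Int.odd_iff, Int.odd_iff, show x % 2 = y % 2 from h']

/-- If `n ≡ 2` and `q - 1 ≡ 2` modulo `4`, and `-1` is an eigenvalue shift, then a lift `v` of a
suitable involution to the extended Weyl group satisfies `λ(v²) = -1`. -/
lemma not_exists_rational_extension [Infinite K] (hq : 1 < p ^ f) {κ : Kˣ →* ℂˣ}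
    (hκ : Function.Injective κ) {ζ : Kˣ} (hζ : orderOf ζ = p ^ f - 1)
    {lam : finiteTorus p f n K → ℂ} {a : Fin n → ℤ}
    (hlam : ∀ (t : finiteTorus p f n K) (d : Fin n → Kˣ), t.1.1 = monomialMatrix 1 d →
      lam t = ((∏ i, κ (d i) ^ a i : ℂˣ) : ℂ))
    (hn : n % 4 = 2) (hq4 : (p ^ f - 1) % 4 = 2) (h2 : (-1 : Kˣ) ≠ 1)
    (hU : (-1 : Kˣ) ∈ eigenShifts fun i => ζ ^ a i) :
    ¬ ∃ lamHat : torusNormalizerStabilizer lam → ℂ, IsIrrChar lamHat ∧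
      (∀ (x : torusNormalizerStabilizer lam) (hx : x.1 ∈ finiteTorus p f n K),
        lamHat x = lam ⟨x.1, hx⟩) ∧
      ∀ x : torusNormalizerStabilizer lam, x.1 ∈ extendedWeylStabilizer lam →
        ∃ r : ℚ, lamHat x = (r : ℂ) := by
  rintro ⟨lamHat, hirr, hext, hrat⟩
  obtain ⟨r, hr, hrodd⟩ : ∃ r : ℕ, p ^ f - 1 = 2 * r ∧ r % 2 = 1 :=
    ⟨(p ^ f - 1) / 2, by omega, by omega⟩
  have hζr : ζ ^ r = -1 := by
    have h1 : ζ ^ r * ζ ^ r = 1 := by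
      rw [← pow_add, ← two_mul, ← hr, ← hζ, pow_orderOf_eq_one]
    have h3 : ζ ^ r ≠ 1 := fun h => by
      have := Nat.le_of_dvd (by omega) (orderOf_dvd_of_pow_eq_one h)
      omega
    rcases mul_self_eq_one_iff.1 (congrArg Units.val h1) with e | e
    · exact absurd (Units.ext e) h3
    · exact Units.ext e
  obtain ⟨w₀, hw₀⟩ := hU
  have heven : 2 ∣ orderOf ζ := by rw [hζ, hr]; exact dvd_mul_right 2 r
  have hrZ : Odd (r : ℤ) := by exact_mod_cast Nat.odd_iff.2 hrodd
  have hshift : ∀ i, ζ ^ a (w₀ i) = ζ ^ ((r : ℤ) + a i) := fun i => by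
    rw [_root_.zpow_add, zpow_natCast, hζr]
    exact hw₀ i
  have hswap : ∀ i, Odd (a (w₀ i)) ↔ ¬ Odd (a i) := fun i => by
    rw [odd_iff_odd_of_zpow_eq heven (hshift i), Int.odd_add, Int.not_odd_iff_even]
    tauto
  obtain ⟨t, ht2, htswap, htw⟩ :=
    exists_swapping_involution (B := fun i => Odd (a i)) hswap
  have hsign : signUnit K t = -1 := by
    apply signUnit_eq_of_sign_eq_neg_one
    rw [sign_of_fixedPointFree_involution ht2 fun i hi => by have := htswap i; rw [hi] at this; tauto,
      Fintype.card_fin]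
    exact Odd.neg_one_pow (Nat.odd_iff.2 (by omega))
  have htshift : ∀ i, ζ ^ a (t i) = ζ ^ ((r : ℤ) + a i) := by
    intro i
    rcases htw i with h | h
    · rw [h, hshift]
    -- Here `w₀ (t i) = i`, so the shift is by `-r`; it agrees with the shift by `r` because `ζ ^ r
    -- = -1` is its own inverse.
    · have := hshift (t i)
      rw [h] at this
      rw [_root_.zpow_add, this, ← _root_.zpow_add, ← add_assoc, _root_.zpow_add, _root_.zpow_add, zpow_natCast, hζr]
      simp
  obtain ⟨v, hv, u, hvu⟩ := exists_mem_extendedWeyl (K := K) t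
  have hu : ∀ i, u i = 1 ∨ u i = -1 := by
    obtain ⟨w', u', h', hu'⟩ := exists_eq_of_mem_extendedWeyl hv
    obtain ⟨-, rfl⟩ := monomialMatrix_inj (h'.symm.trans hvu)
    exact hu'
  have huq : ∀ i, u i ^ p ^ f = u i := by
    intro i
    rcases hu i with e | e
    · rw [e, one_pow]
    · rw [e, ← hζr]
      simpa using zpow_pow_eq_self hq hζ r
  have hvN : v ∈ torusNormalizerStabilizer lam :=
    (mem_charStabilizer_finiteTorus_iff hq hκ hζ hlam _ hvu).2
      ⟨mem_finiteTorusNormalizer_iff.2 ⟨t, u, hvu, huq⟩, r, htshift⟩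
  have hvV : v ∈ extendedWeylStabilizer lam :=
    (mem_charStabilizer_finiteTorus_iff hq hκ hζ hlam _ hvu).2 ⟨hv, r, htshift⟩
  have hvv : (v * v).1 = monomialMatrix 1 fun i => u (t i) * u i := by
    rw [← ht2, ← monomialMatrix_mul, ← hvu]
    rfl
  have hvvT : v * v ∈ finiteTorus p f n K :=
    mem_finiteTorus_iff.2 ⟨_, hvv, fun i => by rw [mul_pow, huq, huq]⟩
  have hlamvv : lam ⟨v * v, hvvT⟩ = -1 := by
    rw [hlam _ _ hvv]
    have hreindex : ∏ i, κ (u (t i)) ^ a i = ∏ i, κ (u i) ^ a (t i) := by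
      rw [← Equiv.prod_comp t]
      refine Finset.prod_congr rfl fun i _ => ?_
      rw [show t (t i) = i from congrArg (· i) ht2]
    -- The combined exponent is `r + 2 * a i` on entries `±1`, and it is odd. Hence the product over
    -- `i` collapses to `κ(∏ u i) = κ(sign t)`.
    have hterm : ∀ i, κ (u i) ^ a (t i) * κ (u i) ^ a i = κ (u i) := by
      intro i
      rw [← map_zpow, zpow_congr_of_pow_eq_self hq hζ (huq i) (htshift i), map_zpow,
        ← _root_.zpow_add]
      have hodd : Odd ((r : ℤ) + a i + a i) := by
        rw [add_assoc]
        exact hrZ.add_even (Even.add_self (a i))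
      rcases hu i with e | e
      · rw [e, map_one, _root_.one_zpow]
      · rw [e, map_neg_one_of_injective h2 hκ, hodd.neg_one_zpow]
    have hprod : ∏ i, κ (u (t i) * u i) ^ a i = -1 := by
      simp only [map_mul, _root_.mul_zpow]
      rw [Finset.prod_mul_distrib, hreindex, ← Finset.prod_mul_distrib,
        Finset.prod_congr rfl fun i _ => hterm i, ← map_prod, prod_eq_signUnit hvu, hsign,
        map_neg_one_of_injective h2 hκ]
    rw [hprod]
    simp
  have hone : lamHat 1 = 1 := by
    have h1 : (1 : SL(n, K)).1 = monomialMatrix 1 1 := monomialMatrix_one_one.symm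
    rw [hext 1 (one_mem _), hlam _ _ h1]
    simp
  obtain ⟨x, hx⟩ := hrat ⟨v, hvN⟩ hvV
  have hsq := hirr.map_mul_of_map_one hone ⟨v, hvN⟩ ⟨v, hvN⟩
  rw [hx, hext _ (show ((⟨v, hvN⟩ * ⟨v, hvN⟩ : torusNormalizerStabilizer lam)).1 ∈
    finiteTorus p f n K from hvvT)] at hsq
  have hsq' : (-1 : ℚ) = x * x := by
    have := hlamvv.symm.trans hsq
    exact_mod_cast this
  nlinarith [mul_self_nonneg x]

end Obstruction

/-! ### 2-parts and the order of the group of eigenvalue shifts -/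

section Arithmetic

lemma ordProj_two_eq_two_iff {x : ℕ} (hx : x ≠ 0) : ordProj[2] x = 2 ↔ x % 4 = 2 := by
  have h1 := Nat.ordProj_mul_ordCompl_eq_self x 2
  have h2 := Nat.not_dvd_ordCompl Nat.prime_two hx
  constructor
  · intro h
    rw [h] at h1 h2
    omega
  · intro h
    generalize x / ordProj[2] x = c at h1 h2
    rcases hk : x.factorization 2 with _ | _ | k
    · rw [hk] at h1; omega
    · rfl
    · rw [hk, pow_succ, pow_succ] at h1
      have : x = 4 * (2 ^ k * c) := by rw [← h1]; ring
      omega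

variable {n : ℕ} {K : Type*} [Field K]

lemma mem_zpowers_of_mem_eigenShifts [NeZero n] {ζ c : Kˣ} {a : Fin n → ℤ}
    (hc : c ∈ eigenShifts fun i => ζ ^ a i) : c ∈ Subgroup.zpowers ζ := by
  obtain ⟨w, hw⟩ := hc
  rw [eq_mul_inv_iff_mul_eq.2 (hw 0).symm]
  exact mul_mem (zpow_mem (Subgroup.mem_zpowers ζ) _) (inv_mem (zpow_mem (Subgroup.mem_zpowers ζ) _))

lemma pow_eq_one_of_mem_eigenShifts {σ : Fin n → Kˣ} {c : Kˣ} (hc : c ∈ eigenShifts σ) :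
    c ^ n = 1 := by
  obtain ⟨w, hw⟩ := hc
  have h := Equiv.prod_comp w σ
  rw [Finset.prod_congr rfl fun i _ => hw i, Finset.prod_mul_distrib, Finset.prod_const,
    Finset.card_univ, Fintype.card_fin] at h
  exact mul_eq_right.1 h

/-- Comparing the products of all `σ i` and all `c * σ i` gives `c ^ n = 1`. A finite subgroup of
`Kˣ` is cyclic, so its order equals its exponent. -/
lemma card_eigenShifts_dvd (σ : Fin n → Kˣ) [Finite (eigenShifts σ)] :
    Nat.card (eigenShifts σ) ∣ n := by
  rw [← IsCyclic.exponent_eq_card]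
  exact Monoid.exponent_dvd_of_forall_pow_eq_one fun c =>
    Subtype.ext (pow_eq_one_of_mem_eigenShifts c.2)

end Arithmetic

/-! ### Existence of the extension and the final equivalence -/

section Criterion

variable {p f n : ℕ} {K : Type*} [Field K] [ExpChar K p]

/-- If `n`, `q - 1` and the number of eigenvalue shifts do not all have `2`-part `2`, then the
character with exponent vector `a` has a rational extension. -/
lemma exists_rational_extension_of_not [Infinite K] [NeZero n] (hq : 1 < p ^ f) {κ : Kˣ →* ℂˣ}
    (hκ : Function.Injective κ) {ζ : Kˣ} (hζ : orderOf ζ = p ^ f - 1)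
    {lam : finiteTorus p f n K → ℂ} {a : Fin n → ℤ}
    (hlam : ∀ (t : finiteTorus p f n K) (d : Fin n → Kˣ), t.1.1 = monomialMatrix 1 d →
      lam t = ((∏ i, κ (d i) ^ a i : ℂˣ) : ℂ))
    [Finite (eigenShifts fun i => ζ ^ a i)]
    (hnot : ¬ (n % 4 = 2 ∧ (p ^ f - 1) % 4 = 2 ∧
      Nat.card (eigenShifts fun i => ζ ^ a i) % 4 = 2)) :
    ∃ lamHat : torusNormalizerStabilizer lam → ℂ, IsIrrChar lamHat ∧
      (∀ (x : torusNormalizerStabilizer lam) (hx : x.1 ∈ finiteTorus p f n K),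
        lamHat x = lam ⟨x.1, hx⟩) ∧
      ∀ x : torusNormalizerStabilizer lam, x.1 ∈ extendedWeylStabilizer lam →
        ∃ r : ℚ, lamHat x = (r : ℂ) := by
  have hsgn : ∀ w : Equiv.Perm (Fin n), signUnit K w = 1 ∨ signUnit K w = -1 := fun w =>
    (Int.units_eq_one_or (Equiv.Perm.sign w)).imp signUnit_eq_of_sign_eq_one
      signUnit_eq_of_sign_eq_neg_one
  by_cases h2 : (-1 : Kˣ) = 1
  -- In characteristic 2 signs are trivial in `K`, so the cocycle vanishes.
  · refine exists_rational_extension hq hκ hζ hlam (fun _ => 1) (fun _ => Or.inl rfl) ?_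
    intro w w' e e' _ _
    have : signUnit K w = 1 := (hsgn w).elim id fun h => h.trans h2
    rw [this, map_one, _root_.one_zpow]
    simp
  have heven : 2 ∣ p ^ f - 1 := by
    have h1 : (-1 : K) ^ p ^ f = -1 := by
      rw [← iterateFrobenius_def, map_neg, map_one]
    rcases Nat.even_or_odd (p ^ f) with h | h
    · rw [h.neg_one_pow] at h1
      exact absurd (Units.ext (by simpa using h1.symm)) h2
    · obtain ⟨k, hk⟩ := h
      omega
  have hκ1 := map_neg_one_of_injective h2 hκ
  by_cases hodd : ∃ (w₀ : Equiv.Perm (Fin n)) (e₀ : ℤ), Odd e₀ ∧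
      ∀ i, ζ ^ a (w₀ i) = ζ ^ (e₀ + a i)
  · obtain ⟨w₀, e₀, he₀, hw₀⟩ := hodd
    have hshift : ∀ (w : Equiv.Perm (Fin n)) (e : ℤ), (∀ i, ζ ^ a (w i) = ζ ^ (e + a i)) →
        (Odd e → ∀ i, Odd (a (w i)) ↔ ¬ Odd (a i)) ∧
        (¬ Odd e → ∀ i, Odd (a (w i)) ↔ Odd (a i)) := by
      intro w e h
      constructor <;> intro he i <;>
        rw [odd_iff_odd_of_zpow_eq (hζ ▸ heven) (h i), Int.odd_add, ← Int.not_odd_iff_even] <;> tauto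
    have h4 : 4 ∣ n := by
      by_contra h4n
      apply hnot
      set m := Nat.card (eigenShifts fun i => ζ ^ a i)
      have hmn : m ∣ n := card_eigenShifts_dvd _
      have hmem : ζ ^ e₀ ∈ eigenShifts fun i => ζ ^ a i :=
        ⟨w₀, fun i => (hw₀ i).trans (_root_.zpow_add ζ e₀ (a i))⟩
      have hdm : orderOf (ζ ^ e₀) ∣ m := by
        have := orderOf_dvd_natCard (⟨ζ ^ e₀, hmem⟩ : eigenShifts fun i => ζ ^ a i)
        rwa [Subgroup.orderOf_mk] at this
      set d := orderOf (ζ ^ e₀)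
      have hqd : ((p ^ f - 1 : ℕ) : ℤ) ∣ e₀ * d := by
        rw [← hζ, orderOf_dvd_iff_zpow_eq_one, _root_.zpow_mul, zpow_natCast, pow_orderOf_eq_one]
      -- As `e₀` is odd, every power of 2 dividing `q - 1` divides the order `d` of `ζ ^ e₀`, hence
      -- also `m` and `n`.
      have hcop : ∀ k : ℕ, ((2 ^ k : ℕ) : ℤ) ∣ e₀ * d → 2 ^ k ∣ d := by
        intro k hk
        have hc : IsCoprime ((2 ^ k : ℕ) : ℤ) e₀ := by
          push_cast
          obtain ⟨l, hl⟩ := he₀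
          exact IsCoprime.pow_left ⟨-l, 1, by rw [hl]; ring⟩
        exact_mod_cast hc.dvd_of_dvd_mul_left hk
      have h2d : 2 ∣ d := hcop 1 ((by exact_mod_cast heven : ((2 ^ 1 : ℕ) : ℤ) ∣ _).trans hqd)
      have h4m : ¬ 4 ∣ m := fun h => h4n (h.trans hmn)
      have h4q : ¬ 4 ∣ p ^ f - 1 := fun h => h4m
        ((hcop 2 ((by exact_mod_cast h : ((2 ^ 2 : ℕ) : ℤ) ∣ _).trans hqd)).trans hdm)
      have h2m : 2 ∣ m := h2d.trans hdm
      have h2n : 2 ∣ n := h2m.trans hmn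
      omega
    obtain ⟨h, hh⟩ := exists_sign_coboundary (B := fun i => Odd (a i))
      (by rwa [Fintype.card_fin]) ((hshift w₀ e₀ hw₀).1 he₀)
    let ι : ℤˣ →* ℂˣ := Units.map (Int.castRingHom ℂ).toMonoidHom
    have hι1 : ι (-1) = -1 := by
      apply Units.ext
      simp [ι]
    have hισ : ∀ w : Equiv.Perm (Fin n), κ (signUnit K w) = ι (Equiv.Perm.sign w) := by
      intro w
      rcases Int.units_eq_one_or (Equiv.Perm.sign w) with e | e
      · rw [signUnit_eq_of_sign_eq_one e, e, map_one, map_one]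
      · rw [signUnit_eq_of_sign_eq_neg_one e, e, hκ1, hι1]
    refine exists_rational_extension hq hκ hζ hlam (fun w => ι (h w)) (fun w => ?_) ?_
    · rcases Int.units_eq_one_or (h w) with e | e
      · exact Or.inl (by rw [e, map_one])
      · exact Or.inr (by rw [e, hι1])
    · intro w w' e e' hw hw'
      have hcase : (∀ i, Odd (a (w i)) ↔ Odd (a i)) ∨ (∀ i, Odd (a (w i)) ↔ ¬ Odd (a i)) :=
        if he : Odd e then Or.inr ((hshift w e hw).1 he) else Or.inl ((hshift w e hw).2 he)
      by_cases he' : Odd e'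
      · rw [(hh w' w hcase).2 ((hshift w' e' hw').1 he'), map_mul, map_mul, hισ]
        congr 1
        rcases Int.units_eq_one_or (Equiv.Perm.sign w) with e | e
        · rw [e, map_one, _root_.one_zpow]
        · rw [e, hι1, he'.neg_one_zpow]
      · rw [(hh w' w hcase).1 ((hshift w' e' hw').2 he'), map_mul]
        rcases hsgn w with e | e
        · rw [e, map_one, _root_.one_zpow, mul_one]
        · rw [e, hκ1, (Int.not_odd_iff_even.1 he').neg_one_zpow, mul_one]
  -- Only even shifts occur, so every factor `κ(sign w) ^ e'` is `1`.
  · push Not at hodd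
    refine exists_rational_extension hq hκ hζ hlam (fun _ => 1) (fun _ => Or.inl rfl) ?_
    intro w w' e e' _ hw'
    have he' : Even e' := by
      rw [← Int.not_odd_iff_even]
      intro he'
      obtain ⟨i, hi⟩ := hodd w' e' he'
      exact hi (hw' i)
    rcases hsgn w with h | h
    · rw [h, map_one, _root_.one_zpow]
      simp
    · rw [h, hκ1, he'.neg_one_zpow]
      simp

/-- Cauchy's theorem gives an element of order 2, and in a field this can only be `-1`. -/
lemma neg_one_mem_of_even_card {G : Subgroup Kˣ} [Finite G] (h : 2 ∣ Nat.card G) :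
    (-1 : Kˣ) ∈ G ∧ (-1 : Kˣ) ≠ 1 := by
  obtain ⟨c, hc⟩ := exists_prime_orderOf_dvd_card' 2 h
  have h1 : (c : Kˣ) ≠ 1 := fun h1 => by
    rw [show c = 1 from Subtype.ext h1, orderOf_one] at hc
    omega
  have h2 : (c : Kˣ) * c = 1 := by
    have := pow_orderOf_eq_one c
    rw [hc, pow_two] at this
    exact congrArg Subtype.val this
  have h3 : (c : Kˣ) = -1 := by
    rcases mul_self_eq_one_iff.1 (congrArg Units.val h2) with e | e
    · exact absurd (Units.ext e) h1
    · exact Units.ext e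
  exact ⟨h3 ▸ c.2, h3 ▸ h1⟩

end Criterion

theorem lemma4p9 (p f n : ℕ) [Fact p.Prime] (hf : 0 < f) (hn : 2 ≤ n)
    -- the choices that fix the duality between `Irr(T)` and `T*`
    (κ : (AlgebraicClosure (ZMod p))ˣ →* ℂˣ) (hκ : Function.Injective κ)
    (ζ : (AlgebraicClosure (ZMod p))ˣ) (hζ : orderOf ζ = p ^ f - 1)
    -- the character `λ ∈ Irr(T)` and the dual element `s ∈ T*`
    (lam : finiteTorus p f n (AlgebraicClosure (ZMod p)) → ℂ) (hlam : IsIrrChar lam)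
    (s : PGL(n, AlgebraicClosure (ZMod p)))
    (hs : s ∈ finiteDualTorus p f n (AlgebraicClosure (ZMod p)))
    (hdual : DualCorrespond κ ζ lam s) :
    (¬ ∃ lamHat : torusNormalizerStabilizer lam → ℂ,
        IsIrrChar lamHat ∧
        -- `lamHat` extends `lam` from `T` to `N_λ`
        (∀ (x : torusNormalizerStabilizer lam)
          (hx : x.1 ∈ finiteTorus p f n (AlgebraicClosure (ZMod p))),
            lamHat x = lam ⟨x.1, hx⟩) ∧
        -- the restriction of `lamHat` to `V_λ` has rational values
        (∀ x : torusNormalizerStabilizer lam, x.1 ∈ extendedWeylStabilizer lam →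
          ∃ r : ℚ, lamHat x = (r : ℂ))) ↔
      ordProj[2] n = 2 ∧ ordProj[2] (p ^ f - 1) = 2 ∧
        ordProj[2] (componentGroupFixed p f s).ncard = 2 := by
  have : NeZero n := ⟨by omega⟩
  have hp : p.Prime := Fact.out
  have hq : 1 < p ^ f := Nat.one_lt_pow hf.ne' hp.one_lt
  obtain ⟨a, rfl, hlamd⟩ := hdual
  have hlama : ∀ (t : finiteTorus p f n (AlgebraicClosure (ZMod p)))
      (d : Fin n → (AlgebraicClosure (ZMod p))ˣ), t.1.1 = monomialMatrix 1 d →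
      lam t = ((∏ i, κ (d i) ^ a i : ℂˣ) : ℂ) :=
    fun t d h => hlamd t d (toGL_eq_diagGL_iff.2 h)
  have hζfin : (Subgroup.zpowers ζ : Set (AlgebraicClosure (ZMod p))ˣ).Finite := by
    rw [finite_zpowers, ← orderOf_pos_iff]
    omega
  have hfin : (eigenShifts fun i => ζ ^ a i : Set (AlgebraicClosure (ZMod p))ˣ).Finite :=
    hζfin.subset fun c hc => mem_zpowers_of_mem_eigenShifts hc
  have : Finite (eigenShifts fun i => ζ ^ a i) := hfin
  rw [ncard_componentGroupFixed _ hfin fun i => congrArg Units.val (zpow_pow_eq_self hq hζ (a i)),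
    ordProj_two_eq_two_iff (NeZero.ne n), ordProj_two_eq_two_iff (by omega),
    ordProj_two_eq_two_iff Nat.card_pos.ne']
  constructor
  · intro h
    by_contra hnot
    exact h (exists_rational_extension_of_not hq hκ hζ hlama hnot)
  · rintro ⟨hn4, hq4, hm4⟩
    obtain ⟨hmem, h2⟩ := neg_one_mem_of_even_card
      (G := eigenShifts fun i => ζ ^ a i) (Nat.dvd_of_mod_eq_zero (by omega))
    exact not_exists_rational_extension hq hκ hζ hlama hn4 hq4 h2 hmem
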